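/- Let $L\ge 0$ be an integer and let $a_1,\dots,a_L,b_1,\dots,b_L$ be real numbers with $a_j\le b_j$ for all $j$ such that $S=\bigcup_{j=1}^L[a_j,b_j]\subseteq[0,1]$ (the intervals are not required to be disjoint). For real $\lambda$ put $e_\lambda(t)=e^{2\pi i\lambda t}$, and for $\Lambda\subseteq\mathbb{R}$ let $E(\Lambda)=\{e_\lambda\}_{\lambda\in\Lambda}$, regarded as a system in $L^2(S)$. A system of vectors in a Hilbert space $H$ is called a Riesz basis of $H$ if it is the image of an orthonormal basis of $H$ under a bounded invertible operator $H\to H$. If the $2L+1$ numbers $a_1,\dots,a_L,b_1,\dots,b_L,1$ are linearly independent over $\mathbb{Q}$ (as a family, so in particular they are pairwise distinct), then there is a set $\Lambda\subseteq\mathbb{Z}$ such that $E(\Lambda)$ is a Riesz basis of $L^2(S)$. -/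

import Mathlib

open MeasureTheory Set

/-- A system of vectors `f : ι → H` of a complex Hilbert space is a *Riesz basis* if it is the image
of an orthonormal basis of `H` under a bounded invertible operator `H → H`. -/
def IsRieszBasis {ι H : Type*} [NormedAddCommGroup H] [InnerProductSpace ℂ H] [CompleteSpace H]
    (f : ι → H) : Prop :=
  ∃ (e : HilbertBasis ι ℂ H) (T : H ≃L[ℂ] H), ∀ i, f i = T (e i)

/-- The exponential `e_l(t) = exp(2 π i l t)` of real frequency `l`. -/
noncomputable def expFun (l t : ℝ) : ℂ :=
  Complex.exp (2 * Real.pi * Complex.I * l * t)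

/-- The system of exponentials with frequencies `(freq i)_i` is a Riesz basis of `L²(S)`: the
exponentials restricted to `S` belong to `L²(S)`, and their classes `f i` there (uniquely determined
by almost everywhere equality on `S`) form a Riesz basis of that space. -/
def IsExpRieszBasis (S : Set ℝ) {ι : Type*} (freq : ι → ℝ) : Prop :=
  ∃ f : ι → Lp ℂ 2 (volume.restrict S),
    (∀ i, f i =ᵐ[volume.restrict S] expFun (freq i)) ∧ IsRieszBasis f

/-!
By Kronecker's theorem there is an `N` such that, modulo `1`, every `N a_j` lies just to the left
of `1/2` and every `N b_j` just to the right. Multiplication by `N` maps `S` to the circle, and the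
number of preimages in `S` of a point `w` is nondecreasing in `w` when it crosses some `N a_j` and
nonincreasing when it crosses some `N b_j`. So each level set `B_j = {w | w has more than j
preimages in S}` is the whole circle or an arc of length less than `1/π` (possibly empty). On such
an arc of length `ℓ`, the frequencies `n / ℓ` of an orthogonal basis may be rounded to integers by
the Paley–Wiener perturbation theorem, so `L²(B_j)` has a Riesz basis of integer frequencies `Λ_j`.

The set `⋃_{j < N} (N Λ_j + j)` is then a spectrum of `S`. Indeed a combination of the corresponding
exponentials has the form `∑_j e_j(t) f_j(N t)`, and the values of this sum at the more than `j`
points of `S` above `w ∈ B_j` determine the terms `f_0(w), …, f_j(w)` through a Vandermonde system,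
up to the terms of higher index; these are dealt with first. Completeness follows from the same
systems transposed, in increasing order of `j`.
-/

theorem le_sqrt_mul_of_sq_le {x y C : ℝ} (hy : 0 ≤ y) (h : x ^ 2 ≤ C * y ^ 2) : x ≤ √C * y :=
  (Real.le_sqrt_of_sq_le h).trans_eq (by rw [Real.sqrt_mul' _ (sq_nonneg y), Real.sqrt_sq hy])

theorem norm_sq_sum_smul_of_orthonormal {ι H : Type*} [NormedAddCommGroup H]
    [InnerProductSpace ℂ H] {v : ι → H} (hv : Orthonormal ℂ v) (s : Finset ι) (c : ι → ℂ) :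
    ‖∑ i ∈ s, c i • v i‖ ^ 2 = ∑ i ∈ s, ‖c i‖ ^ 2 := by
  rw [@norm_sq_eq_re_inner ℂ, hv.inner_sum]
  simp [Complex.conj_mul', ← Complex.ofReal_pow]

section RieszBasis

variable {ι K H : Type*} [NormedAddCommGroup K] [InnerProductSpace ℂ K] [CompleteSpace K]
  [NormedAddCommGroup H] [InnerProductSpace ℂ H] [CompleteSpace H]

/- Polar decomposition: if `P` is the positive square root of `U†U`, then `U ∘ P⁻¹` is unitary. -/
theorem nonempty_linearIsometryEquiv_of_continuousLinearEquiv (U : K ≃L[ℂ] H) :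
    Nonempty (K ≃ₗᵢ[ℂ] H) := by
  let A : K →L[ℂ] H := U
  let G : K →L[ℂ] K := A.adjoint ∘L A
  have hG : 0 ≤ G :=
    (ContinuousLinearMap.nonneg_iff_isPositive G).mpr A.isPositive_adjoint_comp_self
  have hGunit : IsUnit G := by
    let B : H →L[ℂ] K := U.symm
    have hBA : B ∘L A = .id ℂ K := U.coe_symm_comp_coe
    have hAB : A ∘L B = .id ℂ H := U.coe_comp_coe_symm
    refine isUnit_iff_exists.mpr ⟨B ∘L B.adjoint, ?_, ?_⟩
    · change A.adjoint ∘L (A ∘L B) ∘L B.adjoint = .id ℂ K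
      rw [hAB, ContinuousLinearMap.id_comp, ← ContinuousLinearMap.adjoint_comp, hBA,
        ContinuousLinearMap.adjoint_id]
    · change B ∘L (B.adjoint ∘L A.adjoint) ∘L A = .id ℂ K
      rw [← ContinuousLinearMap.adjoint_comp, hAB, ContinuousLinearMap.adjoint_id,
        ContinuousLinearMap.id_comp, hBA]
  obtain ⟨P, hP⟩ : ∃ P : K ≃L[ℂ] K, (P : K →L[ℂ] K) = CFC.sqrt G := by
    obtain ⟨u, hu⟩ := (CFC.isUnit_sqrt_iff G).mpr hGunit
    exact ⟨ContinuousLinearEquiv.unitsEquiv ℂ K u, hu⟩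
  have hnorm : ∀ x, ‖U x‖ = ‖P x‖ := by
    intro x
    have hsa : IsSelfAdjoint (CFC.sqrt G) := IsSelfAdjoint.of_nonneg (CFC.sqrt_nonneg G)
    have hsq : (CFC.sqrt G) (CFC.sqrt G x) = G x :=
      congrArg (fun T : K →L[ℂ] K => T x) (CFC.sqrt_mul_sqrt_self G)
    have hinner : inner ℂ (P x) (P x) = inner ℂ (U x) (U x) := by
      change inner ℂ ((P : K →L[ℂ] K) x) ((P : K →L[ℂ] K) x) = _
      rw [hP, ← ContinuousLinearMap.adjoint_inner_right, hsa.adjoint_eq, hsq]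
      exact ContinuousLinearMap.adjoint_inner_right A x (U x)
    rw [@norm_eq_sqrt_re_inner ℂ, @norm_eq_sqrt_re_inner ℂ _ _ _ _ (P x), hinner]
  exact ⟨⟨(P.symm.trans U).toLinearEquiv, fun x => by simp [hnorm]⟩⟩

theorem denseRange_linearCombination {f : ι → H} (hf : ∀ h, (∀ i, inner ℂ (f i) h = 0) → h = 0) :
    DenseRange (Finsupp.linearCombination ℂ f) := by
  have h : Dense (Submodule.span ℂ (range f) : Set H) := by
    rw [Submodule.dense_iff_topologicalClosure_eq_top, Submodule.topologicalClosure_eq_top_iff,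
      Submodule.eq_bot_iff]
    exact fun h hh => hf h fun i => hh _ (Submodule.subset_span ⟨i, rfl⟩)
  rwa [← Finsupp.range_linearCombination] at h

theorem exists_continuousLinearEquiv_of_bounds (e : HilbertBasis ι ℂ K) {f : ι → H}
    {A B : ℝ} (hA : 0 < A)
    (hlow : ∀ (s : Finset ι) (c : ι → ℂ), A * ∑ i ∈ s, ‖c i‖ ^ 2 ≤ ‖∑ i ∈ s, c i • f i‖ ^ 2)
    (hup : ∀ (s : Finset ι) (c : ι → ℂ), ‖∑ i ∈ s, c i • f i‖ ^ 2 ≤ B * ∑ i ∈ s, ‖c i‖ ^ 2)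
    (hf : ∀ h, (∀ i, inner ℂ (f i) h = 0) → h = 0) :
    ∃ U : K ≃L[ℂ] H, ∀ i, U (e i) = f i := by
  have he : DenseRange (Finsupp.linearCombination ℂ e) :=
    denseRange_linearCombination fun h hh => e.repr.map_eq_zero_iff.mp <| by
      ext i; rw [e.repr_apply_apply]; exact hh i
  have hfd := denseRange_linearCombination hf
  have hnorm : ∀ a, ‖Finsupp.linearCombination ℂ e a‖ ^ 2 = ∑ i ∈ a.support, ‖a i‖ ^ 2 :=
    fun a => norm_sq_sum_smul_of_orthonormal e.orthonormal a.support a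
  have hfe : ∃ C, ∀ a, ‖Finsupp.linearCombination ℂ f a‖ ≤
      C * ‖Finsupp.linearCombination ℂ e a‖ :=
    ⟨√B, fun a => le_sqrt_mul_of_sq_le (norm_nonneg _) (hnorm a ▸ hup a.support a)⟩
  have hef : ∃ C, ∀ a, ‖Finsupp.linearCombination ℂ e a‖ ≤
      C * ‖Finsupp.linearCombination ℂ f a‖ := by
    refine ⟨√A⁻¹, fun a => le_sqrt_mul_of_sq_le (norm_nonneg _) ?_⟩
    rw [hnorm, ← div_eq_inv_mul, le_div_iff₀' hA]
    exact hlow a.support a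
  refine ⟨(LinearEquiv.refl ℂ (ι →₀ ℂ)).extend _ _ he hfe hfd hef, fun i => ?_⟩
  have h := LinearEquiv.extend_eq (LinearEquiv.refl ℂ (ι →₀ ℂ)) _ _ he hfe hfd hef
    (Finsupp.single i 1)
  simpa using h

theorem isRieszBasis_of_bounds {f : ι → H} {A B : ℝ} (hA : 0 < A)
    (hlow : ∀ (s : Finset ι) (c : ι → ℂ), A * ∑ i ∈ s, ‖c i‖ ^ 2 ≤ ‖∑ i ∈ s, c i • f i‖ ^ 2)
    (hup : ∀ (s : Finset ι) (c : ι → ℂ), ‖∑ i ∈ s, c i • f i‖ ^ 2 ≤ B * ∑ i ∈ s, ‖c i‖ ^ 2)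
    (hf : ∀ h, (∀ i, inner ℂ (f i) h = 0) → h = 0) : IsRieszBasis f := by
  let b : HilbertBasis ι ℂ (lp (fun _ : ι => ℂ) 2) := ⟨.refl ℂ _⟩
  obtain ⟨U, hU⟩ := exists_continuousLinearEquiv_of_bounds b hA hlow hup hf
  obtain ⟨W⟩ := nonempty_linearIsometryEquiv_of_continuousLinearEquiv U
  let e : HilbertBasis ι ℂ H := ⟨W.symm⟩
  have he : ∀ i, W.symm (e i) = b i := fun i => W.symm_apply_apply _
  exact ⟨e, W.symm.toContinuousLinearEquiv.trans U, fun i => by simp [he, hU]⟩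

/- A Paley–Wiener theorem: the functional `⟪h, ·⟫` is unchanged if `f i` is replaced by `f i - g i`,
so its norm is at most `θ` times itself. -/
theorem eq_zero_of_forall_inner_eq_zero_of_norm_sub_le {f g : ι → H} {θ : ℝ} (hθ : θ < 1)
    (hfg : ∀ (s : Finset ι) (c : ι → ℂ),
      ‖∑ i ∈ s, c i • (f i - g i)‖ ≤ θ * ‖∑ i ∈ s, c i • f i‖)
    (hf : ∀ h, (∀ i, inner ℂ (f i) h = 0) → h = 0) (h : H) (hgh : ∀ i, inner ℂ (g i) h = 0) :
    h = 0 := by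
  have hbound : ∀ x, ‖inner ℂ h x‖ ≤ ‖h‖ * (θ * ‖x‖) := by
    refine fun x => (denseRange_linearCombination hf).induction_on x
      (isClosed_le (by fun_prop) (by fun_prop)) fun a => ?_
    have heq : inner ℂ h (Finsupp.linearCombination ℂ f a) =
        inner ℂ h (∑ i ∈ a.support, a i • (f i - g i)) := by
      simp only [Finsupp.linearCombination_apply, Finsupp.sum, inner_sum, inner_smul_right,
        inner_sub_right, inner_eq_zero_symm.mp (hgh _), sub_zero]
    rw [heq]
    exact (norm_inner_le_norm _ _).trans (mul_le_mul_of_nonneg_left (hfg _ _) (norm_nonneg h))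
  have hself := hbound h
  rw [inner_self_eq_norm_sq_to_K, norm_pow, RCLike.norm_ofReal, abs_norm] at hself
  by_contra hne
  nlinarith [norm_pos_iff.mpr hne, mul_pos (norm_pos_iff.mpr hne) (norm_pos_iff.mpr hne)]

end RieszBasis

theorem norm_sq_toLp {X : Type*} [MeasurableSpace X] {μ : Measure X} {f : X → ℂ}
    (hf : MemLp f 2 μ) : ‖hf.toLp‖ ^ 2 = ∫ x, ‖f x‖ ^ 2 ∂μ := by
  have h : inner ℂ hf.toLp hf.toLp = ∫ x, ((‖f x‖ ^ 2 : ℝ) : ℂ) ∂μ := by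
    rw [L2.inner_def]
    refine integral_congr_ae ?_
    filter_upwards [hf.coeFn_toLp] with x hx
    rw [hx, inner_self_eq_norm_sq_to_K]
    norm_cast
  rw [@norm_sq_eq_re_inner ℂ, h, integral_complex_ofReal]
  rfl

theorem inner_toLp_left {X : Type*} [MeasurableSpace X] {μ : Measure X} {f : X → ℂ}
    (hf : MemLp f 2 μ) (h : Lp ℂ 2 μ) :
    inner ℂ hf.toLp h = ∫ x, starRingEnd ℂ (f x) * h x ∂μ := by
  rw [L2.inner_def]
  refine integral_congr_ae ?_
  filter_upwards [hf.coeFn_toLp] with x hx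
  rw [hx, RCLike.inner_apply, mul_comm]

/-- A family of square-integrable functions that is complete in `L²(μ)` and satisfies the lower
Riesz inequality. A Riesz basis is such a family that satisfies the upper Riesz inequality too,
which exponentials on subsets of the circle always do. -/
structure IsCompleteRieszFischer {ι X : Type*} [MeasurableSpace X] (μ : Measure X)
    (f : ι → X → ℂ) : Prop where
  memLp : ∀ i, MemLp (f i) 2 μ
  lower_bound : ∃ c > 0, ∀ (s : Finset ι) (a : ι → ℂ),
    c * ∑ i ∈ s, ‖a i‖ ^ 2 ≤ ∫ x, ‖∑ i ∈ s, a i * f i x‖ ^ 2 ∂μ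
  complete : ∀ h : X → ℂ, MemLp h 2 μ → (∀ i, ∫ x, starRingEnd ℂ (f i x) * h x ∂μ = 0) → h =ᵐ[μ] 0

section CompleteRieszFischer

variable {ι X Y : Type*} [MeasurableSpace X] [MeasurableSpace Y] {μ : Measure X} {ν : Measure Y}

theorem memLp_sum_mul {f : ι → X → ℂ} (hf : ∀ i, MemLp (f i) 2 μ) (s : Finset ι) (a : ι → ℂ) :
    MemLp (fun x => ∑ i ∈ s, a i * f i x) 2 μ :=
  memLp_finsetSum s fun i _ => (hf i).const_mul (a i)

theorem sum_smul_toLp {f : ι → X → ℂ} (hf : ∀ i, MemLp (f i) 2 μ) (s : Finset ι) (a : ι → ℂ) :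
    ∑ i ∈ s, a i • (hf i).toLp = (memLp_sum_mul hf s a).toLp := by
  classical
  induction s using Finset.induction_on with
  | empty => simp; rfl
  | insert j s hj ih =>
    rw [Finset.sum_insert hj, ih, ← MemLp.toLp_const_smul, ← MemLp.toLp_add]
    congr 1
    ext x
    simp [Finset.sum_insert hj]

theorem norm_sq_sum_smul_toLp {f : ι → X → ℂ} (hf : ∀ i, MemLp (f i) 2 μ) (s : Finset ι)
    (a : ι → ℂ) :
    ‖∑ i ∈ s, a i • (hf i).toLp‖ ^ 2 = ∫ x, ‖∑ i ∈ s, a i * f i x‖ ^ 2 ∂μ := by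
  rw [sum_smul_toLp, norm_sq_toLp]

theorem forall_inner_toLp_iff {f : ι → X → ℂ} (hf : ∀ i, MemLp (f i) 2 μ) :
    (∀ h : Lp ℂ 2 μ, (∀ i, inner ℂ (hf i).toLp h = 0) → h = 0) ↔
      ∀ h : X → ℂ, MemLp h 2 μ → (∀ i, ∫ x, starRingEnd ℂ (f i x) * h x ∂μ = 0) → h =ᵐ[μ] 0 := by
  simp_rw [inner_toLp_left]
  refine ⟨fun H h hh horth => ?_, fun H h horth => ?_⟩
  · have h0 : hh.toLp = 0 := H _ fun i => by
      rw [← horth i]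
      refine integral_congr_ae ?_
      filter_upwards [hh.coeFn_toLp] with x hx
      rw [hx]
    exact hh.coeFn_toLp.symm.trans (h0 ▸ Lp.coeFn_zero ℂ 2 μ)
  · exact (Lp.eq_zero_iff_ae_eq_zero).mpr (H h (Lp.memLp h) horth)

namespace IsCompleteRieszFischer

theorem isRieszBasis {f : ι → X → ℂ} (hf : IsCompleteRieszFischer μ f) {B : ℝ}
    (hB : ∀ (s : Finset ι) (a : ι → ℂ),
      ∫ x, ‖∑ i ∈ s, a i * f i x‖ ^ 2 ∂μ ≤ B * ∑ i ∈ s, ‖a i‖ ^ 2) :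
    IsRieszBasis fun i => (hf.memLp i).toLp := by
  obtain ⟨A, hA, hlow⟩ := hf.lower_bound
  refine isRieszBasis_of_bounds (B := B) hA (fun s c => ?_) (fun s c => ?_)
    ((forall_inner_toLp_iff hf.memLp).mpr hf.complete)
  · rw [norm_sq_sum_smul_toLp]
    exact hlow s c
  · rw [norm_sq_sum_smul_toLp]
    exact hB s c

theorem injective {f : ι → X → ℂ} (hf : IsCompleteRieszFischer μ f) : Function.Injective f := by
  classical
  obtain ⟨c, hc, hlow⟩ := hf.lower_bound
  intro i j hij
  by_contra hne
  have h := hlow {i, j} (Pi.single i 1 - Pi.single j 1)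
  simp [Finset.sum_pair hne, hij, hne, Ne.symm hne] at h
  linarith

theorem const_mul {f : ι → X → ℂ} (hf : IsCompleteRieszFischer μ f) {u : ι → ℂ}
    (hu : ∀ i, ‖u i‖ = 1) : IsCompleteRieszFischer μ fun i x => u i * f i x where
  memLp i := (hf.memLp i).const_mul (u i)
  lower_bound := by
    obtain ⟨c, hc, hlow⟩ := hf.lower_bound
    refine ⟨c, hc, fun s a => ?_⟩
    simpa [mul_assoc, hu] using hlow s fun i => a i * u i
  complete h hh horth := hf.complete h hh fun i => by
    have hi := horth i
    simp only [map_mul, mul_assoc, integral_const_mul] at hi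
    exact (mul_eq_zero.mp hi).resolve_left
      ((map_ne_zero _).mpr (norm_ne_zero_iff.mp (hu i ▸ one_ne_zero)))

theorem comp_equiv {κ : Type*} {f : ι → X → ℂ} (hf : IsCompleteRieszFischer μ f) (e : κ ≃ ι) :
    IsCompleteRieszFischer μ (f ∘ e) := by
  obtain ⟨c, hc, hlow⟩ := hf.lower_bound
  refine ⟨fun i => hf.memLp (e i), ⟨c, hc, fun s a => ?_⟩, fun h hh horth => ?_⟩
  · simpa [Finset.sum_map] using hlow (s.map e.toEmbedding) (a ∘ e.symm)
  · exact hf.complete h hh fun i => by simpa using horth (e.symm i)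

theorem of_comp {φ : X → Y} (hφ : MeasurePreserving φ μ ν) {f : ι → Y → ℂ}
    (hfm : ∀ i, AEStronglyMeasurable (f i) ν)
    (hf : IsCompleteRieszFischer μ fun i x => f i (φ x)) : IsCompleteRieszFischer ν f := by
  obtain rfl : Measure.map φ μ = ν := hφ.map_eq
  have hmem : ∀ i, MemLp (f i) 2 (Measure.map φ μ) := fun i =>
    (memLp_map_measure_iff (hfm i) hφ.aemeasurable).mpr (hf.memLp i)
  obtain ⟨c, hc, hlow⟩ := hf.lower_bound
  refine ⟨hmem, ⟨c, hc, fun s a => ?_⟩, fun h hh horth => ?_⟩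
  · exact (hlow s a).trans_eq
      (integral_map hφ.aemeasurable ((memLp_sum_mul hmem s a).1.norm.pow 2)).symm
  · have hzero : (fun x => h (φ x)) =ᵐ[μ] 0 := by
      refine hf.complete _ (hh.comp_of_map hφ.aemeasurable) fun i => ?_
      rw [← horth i, integral_map hφ.aemeasurable]
      exact (Complex.continuous_conj.comp_aestronglyMeasurable (hfm i)).mul hh.1
    rw [← eLpNorm_eq_zero_iff hh.1 two_ne_zero, eLpNorm_map_measure hh.1 hφ.aemeasurable]
    exact (eLpNorm_eq_zero_iff (hh.1.comp_aemeasurable hφ.aemeasurable) two_ne_zero).mpr hzero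

theorem of_integral_norm_sq_sub_le {f g : ι → X → ℂ} (hf : IsCompleteRieszFischer μ f)
    (hg : ∀ i, MemLp (g i) 2 μ) {θ : ℝ} (hθ0 : 0 ≤ θ) (hθ : θ < 1)
    (hfg : ∀ (s : Finset ι) (a : ι → ℂ), ∫ x, ‖∑ i ∈ s, a i * (f i x - g i x)‖ ^ 2 ∂μ ≤
      θ ^ 2 * ∫ x, ‖∑ i ∈ s, a i * f i x‖ ^ 2 ∂μ) :
    IsCompleteRieszFischer μ g := by
  have hclose : ∀ (s : Finset ι) (a : ι → ℂ),
      ‖∑ i ∈ s, a i • ((hf.memLp i).toLp - (hg i).toLp)‖ ≤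
        θ * ‖∑ i ∈ s, a i • (hf.memLp i).toLp‖ := by
    intro s a
    rw [← sq_le_sq₀ (norm_nonneg _) (by positivity), mul_pow, norm_sq_sum_smul_toLp]
    simp_rw [← MemLp.toLp_sub]
    rw [norm_sq_sum_smul_toLp fun i => (hf.memLp i).sub (hg i)]
    exact hfg s a
  obtain ⟨c, hc, hlow⟩ := hf.lower_bound
  refine ⟨hg, ⟨(1 - θ) ^ 2 * c, by have := sub_pos.mpr hθ; positivity, fun s a => ?_⟩,
    (forall_inner_toLp_iff hg).mp <| eq_zero_of_forall_inner_eq_zero_of_norm_sub_le hθ hclose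
      ((forall_inner_toLp_iff hf.memLp).mpr hf.complete)⟩
  rw [mul_assoc, ← norm_sq_sum_smul_toLp hg]
  calc (1 - θ) ^ 2 * (c * ∑ i ∈ s, ‖a i‖ ^ 2)
    _ ≤ (1 - θ) ^ 2 * ‖∑ i ∈ s, a i • (hf.memLp i).toLp‖ ^ 2 := by
        rw [norm_sq_sum_smul_toLp]
        gcongr
        exact hlow s a
    _ = ((1 - θ) * ‖∑ i ∈ s, a i • (hf.memLp i).toLp‖) ^ 2 := (mul_pow _ _ _).symm
    _ ≤ ‖∑ i ∈ s, a i • (hg i).toLp‖ ^ 2 := by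
        refine pow_le_pow_left₀ (mul_nonneg (sub_nonneg.mpr hθ.le) (norm_nonneg _)) ?_ 2
        have h := norm_sub_norm_le (∑ i ∈ s, a i • (hf.memLp i).toLp) (∑ i ∈ s, a i • (hg i).toLp)
        simp_rw [← Finset.sum_sub_distrib, ← smul_sub] at h
        linarith [hclose s a]

end IsCompleteRieszFischer

end CompleteRieszFischer

section Fourier

variable {T : ℝ}

theorem norm_fourier_apply (n : ℤ) (t : AddCircle T) : ‖(fourier n t : ℂ)‖ = 1 :=
  Circle.norm_coe _

theorem memLp_fourier {μ : Measure (AddCircle T)} [IsFiniteMeasure μ] (n : ℤ) :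
    MemLp (fun t => (fourier n t : ℂ)) 2 μ :=
  .of_bound (fourier n).continuous.aestronglyMeasurable 1
    (.of_forall fun t => (norm_fourier_apply n t).le)

variable [hT : Fact (0 < T)]

theorem toLp_fourier (n : ℤ) :
    (memLp_fourier (T := T) (μ := AddCircle.haarAddCircle) n).toLp = fourierLp 2 n :=
  Lp.ext ((memLp_fourier n).coeFn_toLp.trans (coeFn_fourierLp 2 n).symm)

theorem integral_norm_sq_sum_fourier_comp {ι : Type*} {k : ι → ℤ} (hk : Function.Injective k)
    (s : Finset ι) (a : ι → ℂ) :
    ∫ t : AddCircle T, ‖∑ i ∈ s, a i * fourier (k i) t‖ ^ 2 = T * ∑ i ∈ s, ‖a i‖ ^ 2 := by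
  have horth : Orthonormal ℂ fun i =>
      (memLp_fourier (T := T) (μ := AddCircle.haarAddCircle) (k i)).toLp := by
    simp only [toLp_fourier]
    exact orthonormal_fourier.comp k hk
  rw [AddCircle.volume_eq_smul_haarAddCircle, integral_smul_measure,
    ENNReal.toReal_ofReal hT.out.le, ← norm_sq_sum_smul_toLp fun i => memLp_fourier (k i),
    norm_sq_sum_smul_of_orthonormal horth, smul_eq_mul]

theorem integral_norm_sq_sum_fourier (s : Finset ℤ) (a : ℤ → ℂ) :
    ∫ t : AddCircle T, ‖∑ n ∈ s, a n * fourier n t‖ ^ 2 = T * ∑ n ∈ s, ‖a n‖ ^ 2 :=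
  integral_norm_sq_sum_fourier_comp Function.injective_id s a

theorem isCompleteRieszFischer_fourier :
    IsCompleteRieszFischer (volume : Measure (AddCircle T)) fun (n : ℤ) t => fourier n t where
  memLp := memLp_fourier
  lower_bound := ⟨T, hT.out, fun s a => (integral_norm_sq_sum_fourier s a).ge⟩
  complete h hh horth := by
    have hT0 : ENNReal.ofReal T ≠ 0 := by simpa using hT.out
    rw [AddCircle.volume_eq_smul_haarAddCircle] at hh horth ⊢
    have hmem : MemLp h 2 (AddCircle.haarAddCircle (T := T)) := by
      have h1 := hh.smul_measure (ENNReal.inv_ne_top.mpr hT0)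
      rwa [smul_smul, ENNReal.inv_mul_cancel hT0 ENNReal.ofReal_ne_top, one_smul] at h1
    refine Measure.ae_smul_measure ((forall_inner_toLp_iff fun n => memLp_fourier n).mp
      (fun h hh => ?_) h hmem fun n => ?_) _
    · refine fourierBasis.repr.map_eq_zero_iff.mp (lp.ext (funext fun n => ?_))
      rw [fourierBasis.repr_apply_apply, coe_fourierBasis, ← toLp_fourier]
      exact hh n
    · simpa [integral_smul_measure, ENNReal.toReal_ofReal hT.out.le, hT.out.ne'] using horth n

end Fourier

theorem IsCompleteRieszFischer.injective_frequency {ι : Type*} {T : ℝ}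
    {μ : Measure (AddCircle T)} {k : ι → ℤ}
    (h : IsCompleteRieszFischer μ fun i t => fourier (k i) t) : Function.Injective k :=
  fun i i' hi => h.injective (by simp only [hi])

/-- A set `B` of the circle has a Riesz spectrum if some exponentials of integer frequency form a
Riesz basis of `L²(B)`. The frequencies are indexed by an arbitrary type; the lower Riesz inequality
makes them distinct. -/
def HasRieszSpectrum (B : Set UnitAddCircle) : Prop :=
  ∃ (ι : Type) (k : ι → ℤ),
    IsCompleteRieszFischer (volume.restrict B) fun (i : ι) t => fourier (k i) t

theorem hasRieszSpectrum_univ : HasRieszSpectrum univ :=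
  ⟨ℤ, id, by rw [Measure.restrict_univ]; exact isCompleteRieszFischer_fourier⟩

theorem hasRieszSpectrum_of_volume_eq_zero {B : Set UnitAddCircle} (hB : volume B = 0) :
    HasRieszSpectrum B := by
  rw [← Measure.restrict_eq_zero] at hB
  refine ⟨Empty, Empty.elim, fun i => i.elim, ⟨1, one_pos, fun s a => ?_⟩, fun h _ _ => ?_⟩
  · simp [Finset.eq_empty_of_isEmpty s]
  · rw [hB, ae_zero]
    exact Filter.eventually_bot


section Perturbation

theorem sq_intervalIntegral_le {ℓ : ℝ} (hℓ : 0 ≤ ℓ) {f : ℝ → ℝ} (hf : Continuous f) :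
    (∫ y in 0..ℓ, f y) ^ 2 ≤ ℓ * ∫ y in 0..ℓ, f y ^ 2 := by
  rcases hℓ.eq_or_lt with rfl | hℓ
  · simp
  have hJensen : (⨍ y in 0..ℓ, f y) ^ 2 ≤ ⨍ y in 0..ℓ, f y ^ 2 :=
    even_two.convexOn_pow.map_set_average_le (continuous_pow 2).continuousOn isClosed_univ
      (by simp [hℓ.ne']) (by simp) (by simp) (hf.integrableOn_uIoc) ((hf.pow 2).integrableOn_uIoc)
  rw [interval_average_eq_div, interval_average_eq_div, sub_zero, div_pow,
    div_le_div_iff₀ (by positivity) hℓ] at hJensen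
  nlinarith

theorem norm_sub_sq_le_mul_integral_norm_deriv_sq {E : Type*} [NormedAddCommGroup E]
    [NormedSpace ℝ E] [CompleteSpace E] {g g' : ℝ → E} (hg : ∀ y, HasDerivAt g (g' y) y)
    (hg' : Continuous g') {ℓ y : ℝ} (hy : y ∈ Icc 0 ℓ) :
    ‖g 0 - g y‖ ^ 2 ≤ ℓ * ∫ z in 0..ℓ, ‖g' z‖ ^ 2 := by
  rw [norm_sub_rev,
    ← intervalIntegral.integral_eq_sub_of_hasDerivAt (fun z _ => hg z) (hg'.intervalIntegrable 0 y)]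
  calc ‖∫ z in 0..y, g' z‖ ^ 2
    _ ≤ (∫ z in 0..ℓ, ‖g' z‖) ^ 2 := by
      gcongr
      exact (intervalIntegral.norm_integral_le_integral_norm hy.1).trans
        (intervalIntegral.integral_mono_interval le_rfl hy.1 hy.2
          (.of_forall fun z => norm_nonneg _) (hg'.norm.intervalIntegrable _ _))
    _ ≤ ℓ * ∫ z in 0..ℓ, ‖g' z‖ ^ 2 := sq_intervalIntegral_le (hy.1.trans hy.2) hg'.norm

theorem hasDerivAt_sum_mul_exp {ι : Type*} (s : Finset ι) (b : ι → ℂ) (δ : ι → ℝ) (y : ℝ) :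
    HasDerivAt (fun y : ℝ => ∑ i ∈ s, b i * Complex.exp (δ i * y * Complex.I))
      (∑ i ∈ s, b i * (δ i * Complex.I * Complex.exp (δ i * y * Complex.I))) y := by
  refine .fun_sum fun i _ => ?_
  have h := (((Complex.ofRealCLM.hasDerivAt (x := y)).const_mul (δ i : ℂ)).mul_const Complex.I).cexp
  refine (h.const_mul (b i)).congr_deriv ?_
  simp [mul_comm]

variable {ι X : Type*}

/-- The `y`-derivative of `∑ i ∈ s, a i * f i x * exp(i δ i y)`, again a combination of the
functions `f i`. -/
noncomputable def modulationDeriv (f : ι → X → ℂ) (δ : ι → ℝ) (s : Finset ι) (a : ι → ℂ)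
    (x : X) (y : ℝ) : ℂ :=
  ∑ i ∈ s, a i * (δ i * Complex.I * Complex.exp (δ i * y * Complex.I)) * f i x

theorem norm_sq_sum_mul_sub_mul_exp_le (f : ι → X → ℂ) (δ : ι → ℝ) (s : Finset ι) (a : ι → ℂ)
    (x : X) {ℓ y : ℝ} (hy : y ∈ Icc 0 ℓ) :
    ‖∑ i ∈ s, a i * (f i x - f i x * Complex.exp (δ i * y * Complex.I))‖ ^ 2 ≤
      ℓ * ∫ z in 0..ℓ, ‖modulationDeriv f δ s a x z‖ ^ 2 := by
  have h := norm_sub_sq_le_mul_integral_norm_deriv_sq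
    (hasDerivAt_sum_mul_exp s (fun i => a i * f i x) δ) (by fun_prop) hy
  simp_rw [← Finset.sum_sub_distrib, mul_right_comm _ (f _ x), mul_assoc (a _) _ (f _ x),
    ← mul_sub] at h
  simpa [modulationDeriv, mul_assoc, mul_comm (f _ x)] using h

theorem norm_deriv_exp_mul_I (δ y : ℝ) :
    ‖(δ * Complex.I * Complex.exp (δ * y * Complex.I) : ℂ)‖ = |δ| := by
  rw [← Complex.ofReal_mul, norm_mul, Complex.norm_exp_ofReal_mul_I]
  simp

variable [TopologicalSpace X] [MeasurableSpace X] [BorelSpace X] [CompactSpace X]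
  {μ : Measure X} [IsFiniteMeasure μ]

theorem integrable_norm_sq_modulationDeriv (f : ι → C(X, ℂ)) (δ : ι → ℝ) (s : Finset ι) (a : ι → ℂ)
    (ℓ : ℝ) : Integrable (fun p : X × ℝ => ‖modulationDeriv (fun i => f i) δ s a p.1 p.2‖ ^ 2)
      (μ.prod (volume.restrict (Ioc 0 ℓ))) := by
  have hcont : Continuous fun p : X × ℝ => modulationDeriv (fun i => f i) δ s a p.1 p.2 := by
    unfold modulationDeriv
    fun_prop
  refine .of_bound (hcont.norm.pow 2).aestronglyMeasurable
    ((∑ i ∈ s, ‖a i‖ * |δ i| * ‖f i‖) ^ 2) (.of_forall fun p => ?_)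
  rw [norm_pow, norm_norm]
  gcongr
  refine norm_sum_le_of_le s fun i _ => ?_
  rw [norm_mul, norm_mul, norm_deriv_exp_mul_I]
  gcongr
  exact (f i).norm_coe_le_norm p.1

theorem integral_norm_sq_sum_mul_sub_mul_exp_le {f : ι → C(X, ℂ)} {B : ℝ}
    (hB : ∀ (s : Finset ι) (a : ι → ℂ),
      ∫ x, ‖∑ i ∈ s, a i * f i x‖ ^ 2 ∂μ ≤ B * ∑ i ∈ s, ‖a i‖ ^ 2) (hB0 : 0 ≤ B) {δ : ι → ℝ} {M : ℝ}
    (hδ : ∀ i, |δ i| ≤ M) {φ : X → ℝ} {ℓ : ℝ} (hℓ : 0 ≤ ℓ) (hφℓ : ∀ x, φ x ∈ Icc 0 ℓ)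
    (s : Finset ι) (a : ι → ℂ) :
    ∫ x, ‖∑ i ∈ s, a i * (f i x - f i x * Complex.exp (δ i * φ x * Complex.I))‖ ^ 2 ∂μ ≤
      (M * ℓ) ^ 2 * (B * ∑ i ∈ s, ‖a i‖ ^ 2) := by
  set D := modulationDeriv (fun i => f i) δ s a
  have hint := integrable_norm_sq_modulationDeriv (μ := μ) f δ s a ℓ
  have hderiv : ∀ y, ∫ x, ‖D x y‖ ^ 2 ∂μ ≤ M ^ 2 * (B * ∑ i ∈ s, ‖a i‖ ^ 2) := by
    intro y
    refine (hB s _).trans ?_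
    rw [mul_left_comm (M ^ 2), Finset.mul_sum s _ (M ^ 2)]
    refine mul_le_mul_of_nonneg_left (Finset.sum_le_sum fun i _ => ?_) hB0
    rw [norm_mul, norm_deriv_exp_mul_I, mul_pow, mul_comm]
    gcongr
    exact hδ i
  calc ∫ x, ‖∑ i ∈ s, a i * (f i x - f i x * Complex.exp (δ i * φ x * Complex.I))‖ ^ 2 ∂μ
    _ ≤ ∫ x, ℓ * (∫ y in 0..ℓ, ‖D x y‖ ^ 2) ∂μ := by
      refine integral_mono_of_nonneg (.of_forall fun x => by positivity) ?_
        (.of_forall fun x => norm_sq_sum_mul_sub_mul_exp_le _ δ s a x (hφℓ x))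
      simp_rw [intervalIntegral.integral_of_le hℓ]
      exact hint.integral_prod_left.const_mul ℓ
    _ = ℓ * ∫ y in 0..ℓ, (∫ x, ‖D x y‖ ^ 2 ∂μ) := by
      simp_rw [intervalIntegral.integral_of_le hℓ]
      rw [integral_const_mul, integral_integral_swap hint]
    _ ≤ ℓ * ∫ _ in 0..ℓ, M ^ 2 * (B * ∑ i ∈ s, ‖a i‖ ^ 2) := by
      refine mul_le_mul_of_nonneg_left (intervalIntegral.integral_mono hℓ ?_ (by simp) hderiv) hℓ
      rw [intervalIntegrable_iff_integrableOn_Ioc_of_le hℓ]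
      exact hint.integral_prod_right
    _ = (M * ℓ) ^ 2 * (B * ∑ i ∈ s, ‖a i‖ ^ 2) := by
      rw [intervalIntegral.integral_const, smul_eq_mul]
      ring

end Perturbation

theorem ae_eq_Ioc_csInf_csSup_of_ordConnected {S : Set ℝ} (hS : S.OrdConnected)
    (hbelow : BddBelow S) (habove : BddAbove S) : S =ᵐ[volume] Ioc (sInf S) (sSup S) := by
  rcases S.eq_empty_or_nonempty with rfl | hne
  · simp
  refine Filter.EventuallyLE.antisymm ?_ (Ioo_ae_eq_Ioc.symm.le.trans ?_)
  · have hsub : S ⊆ Icc (sInf S) (sSup S) := subset_Icc_csInf_csSup hbelow habove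
    exact hsub.eventuallyLE.trans Ioc_ae_eq_Icc.symm.le
  · have hconn : IsConnected S := ⟨hne, hS.isPreconnected⟩
    exact (hconn.Ioo_csInf_csSup_subset hbelow habove).eventuallyLE

section Arc

variable {ℓ : ℝ}

theorem fourier_round_apply (hℓ : ℓ ≠ 0) (α x : ℝ) (n : ℤ) :
    (fourier (round (n / ℓ)) (x : UnitAddCircle) : ℂ) =
      Complex.exp ((2 * Real.pi * (round (n / ℓ) - n / ℓ) : ℝ) * α * Complex.I) *
        (fourier n (x : AddCircle ℓ) *
          Complex.exp ((2 * Real.pi * (round (n / ℓ) - n / ℓ) : ℝ) * (x - α : ℝ) * Complex.I)) := by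
  have hℓ' : (ℓ : ℂ) ≠ 0 := Complex.ofReal_ne_zero.mpr hℓ
  rw [fourier_coe_apply, fourier_coe_apply, ← Complex.exp_add, ← Complex.exp_add]
  congr 1
  push_cast
  field_simp
  ring

theorem abs_two_pi_mul_round_sub_le (x : ℝ) : |2 * Real.pi * (round x - x)| ≤ Real.pi := by
  rw [abs_mul, abs_sub_comm, abs_of_pos Real.two_pi_pos]
  nlinarith [abs_sub_round x, Real.pi_pos]

theorem measurePreserving_coe_equivIoc [Fact (0 < ℓ)] (α : ℝ) :
    MeasurePreserving (fun t : AddCircle ℓ => (AddCircle.equivIoc ℓ α t : ℝ)) volume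
      (volume.restrict (Ioc α (α + ℓ))) :=
  (measurePreserving_subtype_coe measurableSet_Ioc).comp (AddCircle.measurePreserving_equivIoc ℓ)

theorem isCompleteRieszFischer_fourier_round (hℓ : 0 < ℓ) (hℓ1 : Real.pi * ℓ < 1) (α : ℝ) :
    IsCompleteRieszFischer (volume.restrict (Ioc α (α + ℓ))) fun (n : ℤ) (x : ℝ) =>
      fourier (round (n / ℓ)) (x : UnitAddCircle) := by
  have : Fact (0 < ℓ) := ⟨hℓ⟩
  have hlift := measurePreserving_coe_equivIoc (ℓ := ℓ) α
  set φ : AddCircle ℓ → ℝ := fun t => AddCircle.equivIoc ℓ α t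
  set δ : ℤ → ℝ := fun n => 2 * Real.pi * (round (n / ℓ) - n / ℓ)
  set g : ℤ → AddCircle ℓ → ℂ := fun n t =>
    fourier n t * Complex.exp (δ n * (φ t - α : ℝ) * Complex.I)
  have hgL2 : ∀ n, MemLp (g n) 2 volume := by
    refine fun n => .of_bound (Measurable.aestronglyMeasurable ?_) 1 (.of_forall fun t => ?_)
    · have := hlift.measurable
      fun_prop
    · rw [norm_mul, ← Complex.ofReal_mul, Complex.norm_exp_ofReal_mul_I, mul_one]
      exact (norm_fourier_apply n t).le
  have hcomp : IsCompleteRieszFischer volume g := by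
    refine isCompleteRieszFischer_fourier.of_integral_norm_sq_sub_le hgL2 (by positivity) hℓ1 ?_
    intro s a
    rw [integral_norm_sq_sum_fourier]
    exact integral_norm_sq_sum_mul_sub_mul_exp_le
      (fun s a => (integral_norm_sq_sum_fourier s a).le) hℓ.le
      (fun n => abs_two_pi_mul_round_sub_le _) hℓ.le
      (fun t => ⟨by linarith [(AddCircle.equivIoc ℓ α t).2.1],
        by linarith [(AddCircle.equivIoc ℓ α t).2.2]⟩) s a
  refine .of_comp hlift (fun n => by fun_prop) ?_
  convert hcomp.const_mul (u := fun n => Complex.exp (δ n * α * Complex.I)) fun n => ?_ using 3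
    with n t
  · rw [fourier_round_apply hℓ.ne' α, AddCircle.coe_equivIoc]
  · rw [← Complex.ofReal_mul, Complex.norm_exp_ofReal_mul_I]

theorem hasRieszSpectrum_of_ae_eq_Ioc {B : Set UnitAddCircle} (hB : MeasurableSet B) {t α : ℝ}
    (hℓ : 0 < ℓ) (hℓ1 : Real.pi * ℓ < 1)
    (h : ((↑) ⁻¹' B ∩ Ioc t (t + 1) : Set ℝ) =ᵐ[volume] Ioc α (α + ℓ)) : HasRieszSpectrum B := by
  have hmk := (UnitAddCircle.measurePreserving_mk t).restrict_preimage hB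
  rw [Measure.restrict_restrict (AddCircle.measurable_mk' hB), Measure.restrict_congr_set h] at hmk
  exact ⟨ℤ, _, .of_comp hmk (fun n => (fourier _).continuous.aestronglyMeasurable)
    (isCompleteRieszFischer_fourier_round hℓ hℓ1 α)⟩

theorem hasRieszSpectrum_of_ordConnected {B : Set UnitAddCircle} (hB : MeasurableSet B)
    {t p q : ℝ} (hpq : Real.pi * (q - p) < 1) (hsub : (↑) ⁻¹' B ∩ Ioc t (t + 1) ⊆ Icc p q)
    (hord : ((↑) ⁻¹' B ∩ Ioc t (t + 1) : Set ℝ).OrdConnected) : HasRieszSpectrum B := by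
  set S : Set ℝ := (↑) ⁻¹' B ∩ Ioc t (t + 1)
  have hae := ae_eq_Ioc_csInf_csSup_of_ordConnected hord (bddBelow_Icc.mono hsub)
    (bddAbove_Icc.mono hsub)
  rcases le_or_gt (sSup S) (sInf S) with hle | hlt
  · refine hasRieszSpectrum_of_volume_eq_zero ?_
    rw [← (UnitAddCircle.measurePreserving_mk t).measure_preimage hB.nullMeasurableSet,
      Measure.restrict_apply (AddCircle.measurable_mk' hB)]
    rw [Ioc_eq_empty_of_le hle] at hae
    exact measure_congr hae |>.trans measure_empty
  · have hne : S.Nonempty := nonempty_iff_ne_empty.mpr fun h => by simp [h] at hlt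
    have hlen : sSup S - sInf S ≤ q - p :=
      sub_le_sub (csSup_le hne fun x hx => (hsub hx).2) (le_csInf hne fun x hx => (hsub hx).1)
    refine hasRieszSpectrum_of_ae_eq_Ioc (t := t) (α := sInf S) hB (sub_pos.mpr hlt)
      ((mul_le_mul_of_nonneg_left hlen Real.pi_pos.le).trans_lt hpq) ?_
    rwa [add_sub_cancel]

end Arc

section Kronecker

open Filter UnitAddTorus

variable {d : Type*} [Fintype d]

theorem mFourier_add_apply (n : d → ℤ) (s t : UnitAddTorus d) :
    mFourier n (s + t) = mFourier n s * mFourier n t := by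
  simp [mFourier, AddCircle.toCircle_add, Finset.prod_mul_distrib]

theorem integral_mFourier_eq_zero {μ : Measure (UnitAddTorus d)} {ξ : UnitAddTorus d}
    (hμ : MeasurePreserving (ξ + ·) μ μ) {n : d → ℤ} (hn : mFourier n ξ ≠ 1) :
    ∫ t, mFourier n t ∂μ = 0 := by
  have h : mFourier n ξ * ∫ t, mFourier n t ∂μ = ∫ t, mFourier n t ∂μ := by
    rw [← integral_const_mul]
    simp_rw [← mFourier_add_apply]
    exact hμ.integral_comp (measurableEmbedding_addLeft ξ) _
  exact (mul_left_eq_self₀.mp h).resolve_left hn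

theorem ext_of_integral_mFourier {μ ν : Measure (UnitAddTorus d)} [IsFiniteMeasure μ]
    [IsFiniteMeasure ν] (h : ∀ n : d → ℤ, ∫ t, mFourier n t ∂μ = ∫ t, mFourier n t ∂ν) : μ = ν := by
  have hspan : ∀ f ∈ Submodule.span ℂ (range (mFourier (d := d))), ∫ t, f t ∂μ = ∫ t, f t ∂ν := by
    have hint : ∀ (f : C(UnitAddTorus d, ℂ)) (ρ : Measure (UnitAddTorus d)) [IsFiniteMeasure ρ],
        Integrable f ρ := fun f ρ _ =>
      f.continuous.integrable_of_hasCompactSupport (.of_compactSpace f)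
    intro f hf
    induction hf using Submodule.span_induction with
    | mem _ hf => obtain ⟨n, rfl⟩ := hf; exact h n
    | zero => simp
    | add f g _ _ hf hg =>
      simp only [ContinuousMap.add_apply, integral_add (hint f _) (hint g _), hf, hg]
    | smul c f _ hf => simp only [ContinuousMap.smul_apply, integral_smul, hf]
  refine ext_of_forall_mem_subalgebra_integral_eq_of_polish (𝕜 := ℂ)
    (A := (mFourierSubalgebra d).comap (BoundedContinuousFunction.toContinuousMapStarₐ ℂ))
    (fun x y hxy => ?_) fun f hf => hspan _ ?_
  · obtain ⟨_, ⟨f, hf, rfl⟩, hfxy⟩ := mFourierSubalgebra_separatesPoints hxy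
    exact ⟨_, ⟨_, ⟨BoundedContinuousFunction.mkOfCompact f, hf, rfl⟩, rfl⟩, hfxy⟩
  · rw [← mFourierSubalgebra_coe]
    exact hf

/-- Unique ergodicity of irrational rotations of the torus. -/
theorem eq_of_measurePreserving_add_left {ξ : UnitAddTorus d}
    (hξ : ∀ n : d → ℤ, n ≠ 0 → mFourier n ξ ≠ 1) {μ ν : Measure (UnitAddTorus d)}
    [IsProbabilityMeasure μ] [IsProbabilityMeasure ν] (hμ : MeasurePreserving (ξ + ·) μ μ)
    (hν : MeasurePreserving (ξ + ·) ν ν) : μ = ν := by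
  refine ext_of_integral_mFourier fun n => ?_
  rcases eq_or_ne n 0 with rfl | hn
  · simp [mFourier_zero]
  · rw [integral_mFourier_eq_zero hμ (hξ n hn), integral_mFourier_eq_zero hν (hξ n hn)]

/- Haar measure on the closed subgroup generated by `ξ` is invariant under translation by `ξ`, hence
equals Haar measure on the torus, which charges every nonempty open set. -/
theorem topologicalClosure_zmultiples_eq_top {ξ : UnitAddTorus d}
    (hξ : ∀ n : d → ℤ, n ≠ 0 → mFourier n ξ ≠ 1) :
    (AddSubgroup.zmultiples ξ).topologicalClosure = ⊤ := by
  set K := (AddSubgroup.zmultiples ξ).topologicalClosure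
  have hKc : IsClosed (K : Set (UnitAddTorus d)) := AddSubgroup.isClosed_topologicalClosure _
  have : CompactSpace K := isCompact_iff_compactSpace.mp hKc.isCompact
  let k : K := ⟨ξ, subset_closure (AddSubgroup.mem_zmultiples ξ)⟩
  let μ : Measure K := Measure.addHaarMeasure ⊤
  let ν : Measure (UnitAddTorus d) := Measure.addHaarMeasure ⊤
  have : IsProbabilityMeasure μ := ⟨Measure.addHaarMeasure_self⟩
  have : IsProbabilityMeasure ν := ⟨Measure.addHaarMeasure_self⟩
  have hincl : Measurable ((↑) : K → UnitAddTorus d) := measurable_subtype_coe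
  have : IsProbabilityMeasure (μ.map ((↑) : K → UnitAddTorus d)) :=
    Measure.isProbabilityMeasure_map hincl.aemeasurable
  have hinv : MeasurePreserving (ξ + ·) (μ.map ((↑) : K → UnitAddTorus d)) (μ.map (↑)) :=
    (hincl.measurePreserving μ).of_semiconj (measurePreserving_add_left μ k) (fun _ => rfl)
      (measurable_const_add ξ)
  have heq := eq_of_measurePreserving_add_left hξ hinv (measurePreserving_add_left ν ξ)
  have hnull : ν (K : Set (UnitAddTorus d))ᶜ = 0 := by
    rw [← heq, Measure.map_apply hincl hKc.isOpen_compl.measurableSet, preimage_compl,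
      Subtype.coe_preimage_self, compl_univ, measure_empty]
  rw [hKc.isOpen_compl.measure_eq_zero_iff ν, compl_empty_iff] at hnull
  exact SetLike.coe_injective hnull

theorem exists_pos_nsmul_mem_of_isOpen {ξ : UnitAddTorus d}
    (hξ : ∀ n : d → ℤ, n ≠ 0 → mFourier n ξ ≠ 1) {U : Set (UnitAddTorus d)} (hU : IsOpen U)
    (hne : U.Nonempty) : ∃ N : ℕ, 0 < N ∧ N • ξ ∈ U := by
  obtain ⟨u, hu⟩ := hne
  have hclus : MapClusterPt u atTop (· • ξ : ℕ → UnitAddTorus d) := by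
    rw [mapClusterPt_atTop_nsmul_iff_mem_topologicalClosure_zmultiples,
      topologicalClosure_zmultiples_eq_top hξ]
    trivial
  exact (hclus.frequently (hU.mem_nhds hu)).forall_exists_of_atTop 1

theorem mFourier_coe_apply (n : d → ℤ) (x : d → ℝ) :
    mFourier n (fun i => (x i : UnitAddCircle)) =
      Complex.exp ((∑ i, n i * x i : ℝ) * (2 * Real.pi * Complex.I)) := by
  simp only [mFourier, ContinuousMap.coe_mk, fourier_coe_apply]
  rw [← Complex.exp_sum]
  push_cast
  rw [Finset.sum_mul]
  congr! 2
  ring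

/-- Kronecker's theorem on simultaneous inhomogeneous approximation. -/
theorem exists_pos_nat_mul_sub_int_mem_Ioo {x : d → ℝ}
    (hx : ∀ k : d → ℤ, ∀ m : ℤ, ∑ i, k i * x i = m → k = 0) {p q : d → ℝ} (hpq : ∀ i, p i < q i) :
    ∃ N : ℕ, 0 < N ∧ ∀ i, ∃ k : ℤ, N * x i - k ∈ Ioo (p i) (q i) := by
  have hξ : ∀ n : d → ℤ, n ≠ 0 → mFourier n (fun i => (x i : UnitAddCircle)) ≠ 1 := by
    intro n hn h
    rw [mFourier_coe_apply, Complex.exp_eq_one_iff] at h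
    obtain ⟨m, hm⟩ := h
    exact hn (hx n m (by exact_mod_cast mul_right_cancel₀ Complex.two_pi_I_ne_zero hm))
  obtain ⟨N, hN, hNU⟩ := exists_pos_nsmul_mem_of_isOpen hξ
    (U := Set.pi univ fun i => ((↑) : ℝ → UnitAddCircle) '' Ioo (p i) (q i))
    (isOpen_set_pi finite_univ fun i _ => QuotientAddGroup.isOpenMap_coe _ isOpen_Ioo)
    (univ_pi_nonempty_iff.mpr fun i => (nonempty_Ioo.mpr (hpq i)).image _)
  refine ⟨N, hN, fun i => ?_⟩
  obtain ⟨r, hr, hrx⟩ := hNU i (mem_univ i)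
  have hcoe : ((N * x i - r : ℝ) : UnitAddCircle) = 0 := by
    rw [AddCircle.coe_sub, hrx, ← nsmul_eq_mul, AddCircle.coe_nsmul, Pi.smul_apply, sub_self]
  obtain ⟨k, hk⟩ := (AddCircle.coe_eq_zero_iff 1).mp hcoe
  refine ⟨k, ?_⟩
  rw [zsmul_eq_mul, mul_one] at hk
  rwa [hk, sub_sub_cancel]

end Kronecker

section Vandermonde

theorem eq_zero_of_forall_sum_mul_pow_eq_zero {R ι : Type*} [CommRing R] [IsDomain R] {ζ : ι → R}
    (hζ : Function.Injective ζ) {N : ℕ} {k : Fin N} {W : Finset ι} (hk : k < W.card)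
    {x : Fin N → R} (hW : ∀ l ∈ W, ∑ j, x j * ζ l ^ (j : ℕ) = 0) (hx : ∀ j, k < j → x j = 0) :
    x = 0 := by
  classical
  have hdeg : (Polynomial.ofFn N x).degree < W.card :=
    (Polynomial.degree_lt_iff_coeff_zero _ _).mpr fun m hm => by
      rcases lt_or_ge m N with hmN | hmN
      · rw [Polynomial.ofFn_coeff_eq_val_of_lt x hmN]
        exact hx _ (hk.trans_le hm)
      · exact Polynomial.ofFn_coeff_eq_zero_of_ge x hmN
  refine (map_eq_zero_iff _ (Polynomial.injective_ofFn N)).mp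
    (Polynomial.eq_zero_of_degree_lt_of_eval_index_eq_zero W hζ.injOn hdeg fun l hl => ?_)
  simpa [Polynomial.ofFn_eq_sum_monomial, Polynomial.eval_finsetSum] using hW l hl

theorem eq_zero_of_forall_lt_sum_mul_pow_eq_zero {R ι : Type*} [CommRing R] [IsDomain R]
    {ζ : ι → R} (hζ : Function.Injective ζ) {W : Finset ι} {y : ι → R}
    (hW : ∀ j < W.card, ∑ l ∈ W, y l * ζ l ^ j = 0) {l : ι} (hl : l ∈ W) : y l = 0 := by
  set e : Fin W.card ≃ W := W.equivFin.symm
  have h := Matrix.eq_zero_of_forall_pow_sum_mul_pow_eq_zero (f := fun i => ζ (e i))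
    (v := fun i => y (e i)) (fun i j hij => e.injective (Subtype.ext (hζ hij))) fun j => by
      rw [e.sum_comp fun l : W => y l * ζ l ^ (j : ℕ),
        Finset.sum_coe_sort W fun l => y l * ζ l ^ (j : ℕ)]
      exact hW j j.2
  simpa using congrFun h (e.symm ⟨l, hl⟩)

theorem exists_norm_sq_le_mul_sum_norm_sq {𝕜 ι V : Type*} [NontriviallyNormedField 𝕜]
    [CompleteSpace 𝕜] [Fintype ι] [NormedAddCommGroup V] [NormedSpace 𝕜 V] [FiniteDimensional 𝕜 V]
    {φ : ι → V →ₗ[𝕜] 𝕜} (hφ : ∀ x, (∀ i, φ i x = 0) → x = 0) :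
    ∃ C : ℝ, 0 ≤ C ∧ ∀ x, ‖x‖ ^ 2 ≤ C * ∑ i, ‖φ i x‖ ^ 2 := by
  have hker : LinearMap.ker (LinearMap.pi φ) = ⊥ :=
    LinearMap.ker_eq_bot'.mpr fun x hx => hφ x (congrFun hx)
  obtain ⟨K, -, hK⟩ := (LinearMap.pi φ).exists_antilipschitzWith hker
  refine ⟨K ^ 2, by positivity, fun x => ?_⟩
  have hpi : ‖LinearMap.pi φ x‖ ≤ √(∑ i, ‖φ i x‖ ^ 2) := by
    refine (pi_norm_le_iff_of_nonneg (Real.sqrt_nonneg _)).mpr fun i => Real.le_sqrt_of_sq_le ?_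
    exact Finset.single_le_sum (f := fun i => ‖φ i x‖ ^ 2) (fun _ _ => sq_nonneg _)
      (Finset.mem_univ i)
  have hx : ‖x‖ ≤ K * √(∑ i, ‖φ i x‖ ^ 2) := by
    refine le_trans ?_ (mul_le_mul_of_nonneg_left hpi K.2)
    simpa using hK.le_mul_dist x 0
  calc ‖x‖ ^ 2 ≤ (K * √(∑ i, ‖φ i x‖ ^ 2)) ^ 2 := by gcongr
    _ = K ^ 2 * ∑ i, ‖φ i x‖ ^ 2 := by
      rw [mul_pow, Real.sq_sqrt (Finset.sum_nonneg fun _ _ => sq_nonneg _)]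

theorem exists_norm_sq_le_of_lt_card {ι : Type*} {ζ : ι → ℂ} (hζ : Function.Injective ζ) {N : ℕ}
    {k : Fin N} {W : Finset ι} (hk : k < W.card) :
    ∃ C : ℝ, 0 ≤ C ∧ ∀ x : Fin N → ℂ, ‖x k‖ ^ 2 ≤
      C * (∑ l ∈ W, ‖∑ j, x j * ζ l ^ (j : ℕ)‖ ^ 2 + ∑ j ∈ Finset.Ioi k, ‖x j‖ ^ 2) := by
  obtain ⟨C, hC0, hC⟩ := exists_norm_sq_le_mul_sum_norm_sq (𝕜 := ℂ) (V := Fin N → ℂ)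
    (φ := Sum.elim (fun l : W => ∑ j : Fin N, ζ l ^ (j : ℕ) • LinearMap.proj j)
      fun j : Finset.Ioi k => LinearMap.proj j.1) fun x hx => by
        refine eq_zero_of_forall_sum_mul_pow_eq_zero hζ hk (fun l hl => ?_) fun j hj => ?_
        · simpa [mul_comm] using hx (.inl ⟨l, hl⟩)
        · exact hx (.inr ⟨j, Finset.mem_Ioi.mpr hj⟩)
  refine ⟨C, hC0, fun x => (pow_le_pow_left₀ (norm_nonneg _) (norm_le_pi_norm x k) 2).trans ?_⟩
  refine (hC x).trans_eq ?_
  simp [Fintype.sum_sum_type, mul_comm, Finset.sum_attach W fun l => ‖∑ j, x j * ζ l ^ (j : ℕ)‖ ^ 2,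
    Finset.sum_attach (Finset.Ioi k) fun j => ‖x j‖ ^ 2]

theorem exists_forall_norm_sq_le_of_lt_card {ι : Type*} [Finite ι] (N : ℕ) {ζ : ι → ℂ}
    (hζ : Function.Injective ζ) :
    ∃ C : ℝ, 0 ≤ C ∧ ∀ (W : Finset ι) (k : Fin N), k < W.card → ∀ x : Fin N → ℂ, ‖x k‖ ^ 2 ≤
      C * (∑ l ∈ W, ‖∑ j, x j * ζ l ^ (j : ℕ)‖ ^ 2 + ∑ j ∈ Finset.Ioi k, ‖x j‖ ^ 2) := by
  choose! C _ hC using fun p : Finset ι × Fin N =>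
    exists_norm_sq_le_of_lt_card (W := p.1) (k := p.2) hζ
  obtain ⟨M, hM⟩ := (finite_range C).bddAbove
  refine ⟨max M 0, le_max_right _ _, fun W k hk x => (hC (W, k) hk x).trans ?_⟩
  gcongr
  exact (hM ⟨_, rfl⟩).trans (le_max_left _ _)

theorem exists_sum_le_mul_of_forall_le_add_sum_Ioi {N : ℕ} {D : Fin N → ℝ} (hD : ∀ k, 0 ≤ D k) :
    ∃ K : ℝ, 0 ≤ K ∧ ∀ (E : Fin N → ℝ) (I : ℝ),
      (∀ k, E k ≤ D k * (I + ∑ j ∈ Finset.Ioi k, E j)) → ∑ j, E j ≤ K * I := by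
  induction N with
  | zero => exact ⟨0, le_rfl, fun E I _ => by simp⟩
  | succ N ih =>
    obtain ⟨K, hK, h⟩ := ih (D := fun k => D k.succ) fun k => hD _
    refine ⟨D 0 * (1 + K) + K, by have := hD 0; positivity, fun E I hE => ?_⟩
    have htail : ∑ j : Fin N, E j.succ ≤ K * I := h (fun k => E k.succ) I fun k => by
      simpa [← Fin.map_succEmb_Ioi] using hE k.succ
    have hhead : E 0 ≤ D 0 * (I + ∑ j : Fin N, E j.succ) := by
      simpa [Fin.Ioi_zero_eq_map] using hE 0
    rw [Fin.sum_univ_succ]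
    nlinarith [mul_le_mul_of_nonneg_left htail (hD 0)]

end Vandermonde

theorem fourier_add_apply (n : ℤ) (s t : UnitAddCircle) :
    (fourier n (s + t) : ℂ) = fourier n s * fourier n t := by
  simp only [fourier_apply, zsmul_add, AddCircle.toCircle_add, Circle.coe_mul]

theorem fourier_natCast_mul_apply (N : ℕ) (n : ℤ) (t : UnitAddCircle) :
    (fourier (N * n) t : ℂ) = fourier n (N • t) := by
  rw [fourier_apply, fourier_apply, mul_comm, mul_smul, natCast_zsmul]

theorem fourier_natCast_apply (j : ℕ) (t : UnitAddCircle) :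
    (fourier j t : ℂ) = fourier 1 t ^ j := by
  rw [fourier_apply, fourier_one, natCast_zsmul, AddCircle.toCircle_nsmul, Circle.coe_pow]

section Fiber

variable {N : ℕ} [NeZero N]

theorem measurePreserving_nsmul_unitAddCircle :
    MeasurePreserving (fun t : UnitAddCircle => N • t) := by
  simpa using Measure.measurePreserving_zsmul (volume : Measure UnitAddCircle)
    (Int.natCast_ne_zero.mpr (NeZero.ne N))

theorem integral_comp_nsmul {E : Type*} [NormedAddCommGroup E] [NormedSpace ℝ E]
    {F : UnitAddCircle → E} (hF : AEStronglyMeasurable F) : ∫ t, F (N • t) = ∫ t, F t := by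
  have hmp : MeasurePreserving fun t : UnitAddCircle => N • t :=
    measurePreserving_nsmul_unitAddCircle
  rw [← hmp.map_eq] at hF
  rw [← integral_map hmp.measurable.aemeasurable hF, hmp.map_eq]

theorem injective_fourier_one_toAddCircle :
    Function.Injective fun l : ZMod N => (fourier 1 (ZMod.toAddCircle l) : ℂ) := by
  simp only [fourier_one]
  exact Circle.coe_injective.comp
    ((AddCircle.injective_toCircle one_ne_zero).comp (ZMod.toAddCircle_injective N))

theorem nsmul_toAddCircle (l : ZMod N) : N • ZMod.toAddCircle l = 0 := by
  rw [← map_nsmul]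
  simp

theorem nsmul_eq_nsmul_iff_exists_toAddCircle {s t : UnitAddCircle} :
    N • s = N • t ↔ ∃ l : ZMod N, t + ZMod.toAddCircle l = s := by
  refine ⟨fun h => ?_, ?_⟩
  · obtain ⟨m, -, hm⟩ := (AddCircle.nsmul_eq_zero_iff (NeZero.pos N)).mp
      (show N • (s - t) = 0 by rw [nsmul_sub, h, sub_self])
    refine ⟨m, ?_⟩
    rw [ZMod.toAddCircle_natCast, ← mul_one ((m : ℝ) / N), hm, add_sub_cancel]
  · rintro ⟨l, rfl⟩
    rw [nsmul_add, nsmul_toAddCircle, add_zero]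

open scoped Classical in
/-- The `l` modulo `N` with `t + l / N ∈ S`; they parametrize the points of `S` that multiplication
by `N` maps to `N • t`. -/
noncomputable def fiberIndices (N : ℕ) [NeZero N] (S : Set UnitAddCircle) (t : UnitAddCircle) :
    Finset (ZMod N) :=
  {l | t + ZMod.toAddCircle l ∈ S}

/-- The number of points of `S` that multiplication by `N` maps to `w`. -/
noncomputable def preimageCount (N : ℕ) (S : Set UnitAddCircle) (w : UnitAddCircle) : ℕ :=
  {t ∈ S | N • t = w}.ncard

/-- The points of the circle that have more than `j` preimages in `S` under multiplication
by `N`. -/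
def levelSet (N : ℕ) (S : Set UnitAddCircle) (j : ℕ) : Set UnitAddCircle :=
  {w | j < preimageCount N S w}

variable {S : Set UnitAddCircle} {t : UnitAddCircle}

theorem mem_fiberIndices {l : ZMod N} :
    l ∈ fiberIndices N S t ↔ t + ZMod.toAddCircle l ∈ S := by
  simp [fiberIndices]

theorem preimageCount_nsmul : preimageCount N S (N • t) = (fiberIndices N S t).card := by
  have himage : {s ∈ S | N • s = N • t} =
      (fun l => t + ZMod.toAddCircle l) '' (fiberIndices N S t : Set (ZMod N)) := by
    ext s
    simp only [mem_ofPred_eq, nsmul_eq_nsmul_iff_exists_toAddCircle, mem_image, Finset.mem_coe,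
      mem_fiberIndices]
    constructor
    · rintro ⟨hs, l, rfl⟩
      exact ⟨l, hs, rfl⟩
    · rintro ⟨l, hl, rfl⟩
      exact ⟨hl, l, rfl⟩
  have hinj : Function.Injective fun l : ZMod N => t + ZMod.toAddCircle l :=
    (add_right_injective t).comp (ZMod.toAddCircle_injective N)
  rw [preimageCount, himage, ncard_image_of_injective _ hinj, ncard_coe_finset]

theorem nsmul_mem_levelSet {j : ℕ} : N • t ∈ levelSet N S j ↔ j < (fiberIndices N S t).card := by
  rw [← preimageCount_nsmul]
  rfl

theorem measurable_card_fiberIndices (hS : MeasurableSet S) :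
    Measurable fun t => (fiberIndices N S t).card := by
  classical
  simp_rw [fiberIndices, Finset.card_filter]
  exact Finset.measurable_fun_sum _ fun l _ =>
    Measurable.ite (measurable_add_const _ hS) measurable_const measurable_const

/-- A measurable section of multiplication by `N` on the circle. -/
noncomputable def divSection (N : ℕ) (w : UnitAddCircle) : UnitAddCircle :=
  ((AddCircle.measurableEquivIoc (1 : ℝ) 0 w / N : ℝ) : UnitAddCircle)

theorem measurable_divSection (N : ℕ) : Measurable (divSection N) :=
  AddCircle.measurable_mk'.comp ((measurable_subtype_coe.comp
    (AddCircle.measurableEquivIoc (1 : ℝ) 0).measurable).div_const _)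

theorem nsmul_divSection (w : UnitAddCircle) : N • divSection N w = w := by
  rw [divSection, ← AddCircle.coe_nsmul, nsmul_eq_mul, mul_div_cancel₀ _ (NeZero.ne (N : ℝ))]
  exact (AddCircle.measurableEquivIoc (1 : ℝ) 0).symm_apply_apply w

theorem measurableSet_levelSet (hS : MeasurableSet S) (j : ℕ) : MeasurableSet (levelSet N S j) := by
  convert (measurable_card_fiberIndices (N := N) hS).comp (measurable_divSection N)
    (measurableSet_Ioi (a := j)) using 1
  ext w
  rw [mem_preimage, Function.comp_apply, mem_Ioi, ← nsmul_mem_levelSet, nsmul_divSection]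

theorem integral_sum_add_toAddCircle {E : Type*} [NormedAddCommGroup E] [NormedSpace ℝ E]
    {F : UnitAddCircle → E} (hF : Integrable F) :
    ∫ t, ∑ l : ZMod N, F (t + ZMod.toAddCircle l) = N • ∫ t, F t := by
  rw [integral_finsetSum _ fun l _ => hF.comp_add_right _]
  simp only [integral_add_right_eq_self F, Finset.sum_const, Finset.card_univ, ZMod.card]

theorem memLp_fourier_mul {μ : Measure UnitAddCircle} (n : ℤ) {h : UnitAddCircle → ℂ}
    (hh : MemLp h 2 μ) : MemLp (fun t => fourier n t * h t) 2 μ :=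
  hh.congr_norm ((fourier n).continuous.aestronglyMeasurable.mul hh.1)
    (.of_forall fun t => by rw [norm_mul, norm_fourier_apply, one_mul])

end Fiber

section Polyphase

variable {N : ℕ}

/-- The polyphase synthesis `∑ j, e_j(t) f_j(N t)` of `N` functions on the circle. If `f_j` has
spectrum `Λ_j`, the result has spectrum `⋃ j, (N Λ_j + j)`. -/
noncomputable def polyphaseSum (f : Fin N → UnitAddCircle → ℂ) (t : UnitAddCircle) : ℂ :=
  ∑ j : Fin N, fourier (j : ℕ) t * f j (N • t)

theorem sum_sigma_mul_fourier {ι : Fin N → Type*} (k : ∀ j, ι j → ℤ) (σ : ∀ j, Finset (ι j))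
    (a : (Σ j, ι j) → ℂ) (t : UnitAddCircle) :
    ∑ p ∈ Finset.univ.sigma σ, a p * fourier (N * k p.1 p.2 + (p.1 : ℕ)) t =
      polyphaseSum (fun j w => ∑ i ∈ σ j, a ⟨j, i⟩ * fourier (k j i) w) t := by
  simp only [Finset.sum_sigma, polyphaseSum, Finset.mul_sum, fourier_add,
    fourier_natCast_mul_apply]
  refine Finset.sum_congr rfl fun j _ => Finset.sum_congr rfl fun i _ => ?_
  ring

variable [NeZero N]

theorem polyphaseSum_add_toAddCircle (f : Fin N → UnitAddCircle → ℂ) (t : UnitAddCircle)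
    (l : ZMod N) : polyphaseSum f (t + ZMod.toAddCircle l) =
      ∑ j : Fin N, fourier (j : ℕ) t * f j (N • t) * fourier 1 (ZMod.toAddCircle l) ^ (j : ℕ) := by
  refine Finset.sum_congr rfl fun j _ => ?_
  rw [fourier_add_apply, nsmul_add, nsmul_toAddCircle, add_zero, ← fourier_natCast_apply]
  ring

theorem memLp_polyphaseSum {f : Fin N → UnitAddCircle → ℂ} (hf : ∀ j, MemLp (f j) 2) :
    MemLp (polyphaseSum f) 2 :=
  memLp_finsetSum _ fun j _ => memLp_fourier_mul _
    ((hf j).comp_measurePreserving measurePreserving_nsmul_unitAddCircle)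

/- The `N`-th roots of unity `e_1(l / N)` recover the terms `e_j(t) f_j(N t)` with `j ≤ k` from more
than `k` values of the sum on `t + ℤ / N`, up to the terms with `j > k`. -/
theorem exists_norm_sq_le_of_nsmul_mem_levelSet (N : ℕ) [NeZero N] :
    ∃ C : ℝ, 0 ≤ C ∧ ∀ (S : Set UnitAddCircle) (f : Fin N → UnitAddCircle → ℂ) (k : Fin N)
      (t : UnitAddCircle), N • t ∈ levelSet N S k → ‖f k (N • t)‖ ^ 2 ≤
        C * (∑ l : ZMod N, S.indicator (fun t => ‖polyphaseSum f t‖ ^ 2) (t + ZMod.toAddCircle l) +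
          ∑ j ∈ Finset.Ioi k, ‖f j (N • t)‖ ^ 2) := by
  classical
  obtain ⟨C, hC0, hC⟩ := exists_forall_norm_sq_le_of_lt_card N
    (injective_fourier_one_toAddCircle (N := N))
  refine ⟨C, hC0, fun S f k t ht => ?_⟩
  have h := hC _ k (nsmul_mem_levelSet.mp ht) fun j => fourier (j : ℕ) t * f j (N • t)
  simp only [← polyphaseSum_add_toAddCircle, norm_mul, norm_fourier_apply, one_mul] at h
  simpa [fiberIndices, Finset.sum_filter, indicator_apply] using h

theorem exists_setIntegral_levelSet_le {S : Set UnitAddCircle} (hS : MeasurableSet S) :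
    ∃ C : ℝ, 0 ≤ C ∧ ∀ f : Fin N → UnitAddCircle → ℂ, (∀ j, MemLp (f j) 2) → ∀ k : Fin N,
      ∫ w in levelSet N S k, ‖f k w‖ ^ 2 ≤
        C * (N * (∫ t in S, ‖polyphaseSum f t‖ ^ 2) + ∑ j ∈ Finset.Ioi k, ∫ w, ‖f j w‖ ^ 2) := by
  obtain ⟨C, hC0, hC⟩ := exists_norm_sq_le_of_nsmul_mem_levelSet N
  refine ⟨C, hC0, fun f hf k => ?_⟩
  have hlevel := measurableSet_levelSet (N := N) hS k
  have hmp : MeasurePreserving (fun t : UnitAddCircle => N • t) :=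
    measurePreserving_nsmul_unitAddCircle
  set F : UnitAddCircle → ℝ := S.indicator fun t => ‖polyphaseSum f t‖ ^ 2
  have hF : Integrable F := (memLp_polyphaseSum hf).norm.integrable_sq.indicator hS
  have hFsum : Integrable fun t => ∑ l : ZMod N, F (t + ZMod.toAddCircle l) :=
    integrable_finsetSum _ fun l _ => hF.comp_add_right _
  have hsq : ∀ j, Integrable fun w => ‖f j w‖ ^ 2 :=
    fun j => (hf j).norm.integrable_sq
  have hsqN : ∀ j, Integrable fun t => ‖f j (N • t)‖ ^ 2 := fun j =>
    ((hf j).comp_measurePreserving hmp).norm.integrable_sq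
  have hsqNsum : Integrable fun t => ∑ j ∈ Finset.Ioi k, ‖f j (N • t)‖ ^ 2 :=
    integrable_finsetSum _ fun j _ => hsqN j
  set G : UnitAddCircle → ℝ := (levelSet N S k).indicator fun w => ‖f k w‖ ^ 2
  have hG : Integrable G := (hsq k).indicator hlevel
  have hGN : Integrable fun t => G (N • t) := (hmp.integrable_comp hG.1).mpr hG
  have hpointwise : ∀ t, G (N • t) ≤ C * (∑ l : ZMod N, F (t + ZMod.toAddCircle l) +
      ∑ j ∈ Finset.Ioi k, ‖f j (N • t)‖ ^ 2) := fun t =>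
    indicator_apply_le' (hC S f k t) fun _ => mul_nonneg hC0 <| add_nonneg
      (Finset.sum_nonneg fun l _ => indicator_nonneg (fun t _ => by positivity) _) (by positivity)
  calc ∫ w in levelSet N S k, ‖f k w‖ ^ 2
      = ∫ t, G (N • t) := by
        rw [← integral_indicator hlevel, integral_comp_nsmul hG.aestronglyMeasurable]
    _ ≤ ∫ t, C * (∑ l : ZMod N, F (t + ZMod.toAddCircle l) +
          ∑ j ∈ Finset.Ioi k, ‖f j (N • t)‖ ^ 2) :=
        integral_mono hGN ((hFsum.add hsqNsum).const_mul C) fun t => hpointwise t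
    _ = C * (N * (∫ t in S, ‖polyphaseSum f t‖ ^ 2) + ∑ j ∈ Finset.Ioi k, ∫ w, ‖f j w‖ ^ 2) := by
        have hcomp (j : Fin N) : ∫ t, ‖f j (N • t)‖ ^ 2 = ∫ w, ‖f j w‖ ^ 2 :=
          integral_comp_nsmul (F := fun w => ‖f j w‖ ^ 2) (hsq j).aestronglyMeasurable
        rw [integral_const_mul, integral_add hFsum hsqNsum,
          integral_sum_add_toAddCircle hF, integral_indicator hS, nsmul_eq_mul,
          integral_finsetSum _ fun j _ => hsqN j]
        simp only [hcomp]

theorem exists_mul_sum_norm_sq_le_integral_sigma {S : Set UnitAddCircle} (hS : MeasurableSet S)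
    {ι : Fin N → Type*} {k : ∀ j, ι j → ℤ}
    (hk : ∀ j : Fin N, IsCompleteRieszFischer (volume.restrict (levelSet N S j))
      fun (i : ι j) t => fourier (k j i) t) :
    ∃ c > 0, ∀ (s : Finset (Σ j, ι j)) (a : (Σ j, ι j) → ℂ), c * ∑ p ∈ s, ‖a p‖ ^ 2 ≤
      ∫ t in S, ‖∑ p ∈ s, a p * fourier (N * k p.1 p.2 + (p.1 : ℕ)) t‖ ^ 2 := by
  classical
  choose c hc0 hc using fun j => (hk j).lower_bound
  obtain ⟨C, hC0, hC⟩ := exists_setIntegral_levelSet_le (N := N) hS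
  obtain ⟨K, hK0, hK⟩ := exists_sum_le_mul_of_forall_le_add_sum_Ioi (N := N)
    (D := fun j => C / c j) fun j => div_nonneg hC0 (hc0 j).le
  have hN : (0 : ℝ) < N := Nat.cast_pos.mpr (NeZero.pos N)
  refine ⟨((K + 1) * N)⁻¹, by positivity, fun s a => ?_⟩
  set σ : ∀ j, Finset (ι j) := fun j => s.preimage (Sigma.mk j) sigma_mk_injective.injOn with hσ
  have hs : Finset.univ.sigma σ = s := by ext; simp [hσ]
  set f : Fin N → UnitAddCircle → ℂ := fun j w => ∑ i ∈ σ j, a ⟨j, i⟩ * fourier (k j i) w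
  have hf : ∀ j, MemLp (f j) 2 := fun j => memLp_sum_mul (fun i => memLp_fourier _) _ _
  have hnorm : ∀ j, ∫ w, ‖f j w‖ ^ 2 = ∑ i ∈ σ j, ‖a ⟨j, i⟩‖ ^ 2 := fun j => by
    rw [integral_norm_sq_sum_fourier_comp (hk j).injective_frequency, one_mul]
  have hsum := hK (fun j => ∑ i ∈ σ j, ‖a ⟨j, i⟩‖ ^ 2) (N * ∫ t in S, ‖polyphaseSum f t‖ ^ 2)
    fun j => by
      rw [div_mul_eq_mul_div, le_div_iff₀' (hc0 j)]
      simpa only [hnorm] using (hc j (σ j) fun i => a ⟨j, i⟩).trans (hC f hf j)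
  simp_rw [← hs, sum_sigma_mul_fourier, Finset.sum_sigma]
  rw [inv_mul_le_iff₀ (by positivity)]
  refine hsum.trans ?_
  have hI : 0 ≤ N * ∫ t in S, ‖polyphaseSum f t‖ ^ 2 := by positivity
  linarith

end Polyphase

section Completeness

variable {N : ℕ} [NeZero N] {S : Set UnitAddCircle} {h : UnitAddCircle → ℂ} {t : UnitAddCircle}

/-- The sum of `e_{-j} h` over the fiber `t + ℤ / N` of multiplication by `N`. As a function of
`N t`, it has the Fourier coefficients of `N h` at the frequencies `N m + j`. -/
noncomputable def fiberSum (N : ℕ) [NeZero N] (h : UnitAddCircle → ℂ) (j : ℕ)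
    (t : UnitAddCircle) : ℂ :=
  ∑ l : ZMod N, fourier (-(j : ℤ)) (t + ZMod.toAddCircle l) * h (t + ZMod.toAddCircle l)

theorem fiberSum_eq_of_nsmul_eq {s : UnitAddCircle} (hst : N • s = N • t) (j : ℕ) :
    fiberSum N h j s = fiberSum N h j t := by
  obtain ⟨k, rfl⟩ := nsmul_eq_nsmul_iff_exists_toAddCircle.mp hst
  simp only [fiberSum, add_assoc, ← map_add]
  exact Equiv.sum_comp (Equiv.addLeft k) fun l =>
    fourier (-(j : ℤ)) (t + ZMod.toAddCircle l) * h (t + ZMod.toAddCircle l)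

theorem fiberSum_divSection_nsmul (j : ℕ) :
    fiberSum N h j (divSection N (N • t)) = fiberSum N h j t :=
  fiberSum_eq_of_nsmul_eq (nsmul_divSection _) j

theorem measurable_fiberSum (hm : Measurable h) (j : ℕ) : Measurable (fiberSum N h j) :=
  Finset.measurable_fun_sum _ fun _ _ =>
    ((fourier _).continuous.measurable.mul hm).comp (measurable_add_const _)

theorem memLp_fiberSum_divSection (hm : Measurable h) (hh : MemLp h 2) (j : ℕ) :
    MemLp (fun w => fiberSum N h j (divSection N w)) 2 := by
  have hmp : MeasurePreserving fun t : UnitAddCircle => N • t :=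
    measurePreserving_nsmul_unitAddCircle
  have hH := (measurable_fiberSum (N := N) hm j).comp (measurable_divSection N)
  rw [← hmp.map_eq]
  refine (memLp_map_measure_iff hH.aestronglyMeasurable hmp.measurable.aemeasurable).mpr ?_
  simp only [Function.comp_def, fiberSum_divSection_nsmul]
  exact memLp_finsetSum _ fun l _ => (memLp_fourier_mul (-(j : ℤ)) hh).comp_measurePreserving
    (measurePreserving_add_right volume (ZMod.toAddCircle l))

theorem integral_fourier_neg_mul_fiberSum (hm : Measurable h) (hh : MemLp h 2) (j : ℕ) (m : ℤ) :
    ∫ w, fourier (-m) w * fiberSum N h j (divSection N w) =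
      N * ∫ t, fourier (-(N * m + j)) t * h t := by
  have hmul := (memLp_fourier_mul (-m) (memLp_fiberSum_divSection (N := N) hm hh j)).1
  have hint : Integrable fun t => fourier (-(N * m + j)) t * h t :=
    (memLp_fourier_mul _ hh).integrable one_le_two
  rw [← nsmul_eq_mul, ← integral_sum_add_toAddCircle hint, ← integral_comp_nsmul (N := N) hmul]
  refine integral_congr_ae (.of_forall fun t => ?_)
  simp only [fiberSum_divSection_nsmul]
  simp only [fiberSum, Finset.mul_sum]
  refine Finset.sum_congr rfl fun l _ => ?_
  rw [neg_add, ← mul_neg, fourier_add, fourier_natCast_mul_apply, nsmul_add, nsmul_toAddCircle,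
    add_zero, mul_assoc]

theorem fiberSum_eq_mul_sum (hsupp : ∀ s ∉ S, h s = 0) (j : ℕ) :
    fiberSum N h j t = fourier (-(j : ℤ)) t * ∑ l ∈ fiberIndices N S t,
      h (t + ZMod.toAddCircle l) * (fourier 1 (ZMod.toAddCircle l))⁻¹ ^ j := by
  rw [fiberSum, Finset.mul_sum]
  symm
  refine Finset.sum_subset_zero_on_sdiff (Finset.subset_univ _) (fun l hl => ?_) fun l _ => ?_
  · rw [hsupp _ (mt mem_fiberIndices.mpr (Finset.mem_sdiff.mp hl).2), mul_zero]
  · rw [fourier_add_apply, fourier_neg (x := ZMod.toAddCircle l), fourier_natCast_apply, inv_pow,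
      ← Complex.inv_eq_conj (by rw [norm_pow, norm_fourier_apply, one_pow])]
    ring

/- The fiber sums of order less than the number of points of `t + ℤ / N` in `S` form an invertible
Vandermonde system in the values of `h` at these points. -/
theorem eq_zero_of_forall_fiberSum_eq_zero (hsupp : ∀ s ∉ S, h s = 0)
    (hsum : ∀ j < (fiberIndices N S t).card, fiberSum N h j t = 0) (l : ZMod N) :
    h (t + ZMod.toAddCircle l) = 0 := by
  by_cases hl : t + ZMod.toAddCircle l ∈ S
  · refine eq_zero_of_forall_lt_sum_mul_pow_eq_zero
      (y := fun l => h (t + ZMod.toAddCircle l))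
      (inv_injective.comp (injective_fourier_one_toAddCircle (N := N))) (fun j hj => ?_)
      (mem_fiberIndices.mpr hl)
    have hj0 := hsum j hj
    rw [fiberSum_eq_mul_sum hsupp] at hj0
    refine (mul_eq_zero.mp hj0).resolve_left (norm_ne_zero_iff.mp ?_)
    rw [norm_fourier_apply]
    exact one_ne_zero
  · exact hsupp _ hl

theorem ae_fiberSum_divSection_eq_zero (hS : MeasurableSet S) {ι : Fin N → Type*}
    {k : ∀ j, ι j → ℤ} (hk : ∀ j : Fin N, IsCompleteRieszFischer
      (volume.restrict (levelSet N S j)) fun (i : ι j) t => fourier (k j i) t)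
    (hm : Measurable h) (hh : MemLp h 2) (hsupp : ∀ s ∉ S, h s = 0)
    (horth : ∀ j i, ∫ t, fourier (-(N * k j i + (j : ℕ))) t * h t = 0) (j : Fin N) :
    ∀ᵐ w, fiberSum N h j (divSection N w) = 0 := by
  induction j using WellFoundedLT.induction with
  | ind j ih =>
    set H : UnitAddCircle → ℂ := fun w => fiberSum N h j (divSection N w)
    have hoff : ∀ᵐ w, w ∉ levelSet N S j → H w = 0 := by
      filter_upwards [ae_all_iff.mpr fun i => ae_all_iff.mpr (ih i)] with w hw hwj
      have hcard : (fiberIndices N S (divSection N w)).card ≤ j := by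
        rwa [← not_lt, ← nsmul_mem_levelSet, nsmul_divSection]
      have h0 := eq_zero_of_forall_fiberSum_eq_zero hsupp fun i hi =>
        hw ⟨i, (hi.trans_le hcard).trans j.2⟩ (hi.trans_le hcard)
      exact Finset.sum_eq_zero fun l _ => by rw [h0, mul_zero]
    have hon : H =ᵐ[volume.restrict (levelSet N S j)] 0 := by
      refine (hk j).complete H ((memLp_fiberSum_divSection hm hh j).restrict _) fun i => ?_
      simp only [← fourier_neg]
      rw [setIntegral_eq_integral_of_ae_compl_eq_zero
          (hoff.mono fun w hw hwj => by rw [hw hwj, mul_zero]),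
        integral_fourier_neg_mul_fiberSum hm hh, horth, mul_zero]
    filter_upwards [hoff, (ae_restrict_iff' (measurableSet_levelSet (N := N) hS j)).mp hon]
      with w hwoff hwon
    exact (em _).elim hwon hwoff

theorem ae_eq_zero_of_forall_integral_sigma_eq_zero (hS : MeasurableSet S) {ι : Fin N → Type*}
    {k : ∀ j, ι j → ℤ} (hk : ∀ j : Fin N, IsCompleteRieszFischer
      (volume.restrict (levelSet N S j)) fun (i : ι j) t => fourier (k j i) t)
    (hm : Measurable h) (hh : MemLp h 2) (hsupp : ∀ s ∉ S, h s = 0)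
    (horth : ∀ j i, ∫ t, fourier (-(N * k j i + (j : ℕ))) t * h t = 0) : h =ᵐ[volume] 0 := by
  have hfiber : ∀ᵐ w, ∀ j : Fin N, fiberSum N h j (divSection N w) = 0 :=
    ae_all_iff.mpr (ae_fiberSum_divSection_eq_zero hS hk hm hh hsupp horth)
  have hmp : MeasurePreserving fun t : UnitAddCircle => N • t :=
    measurePreserving_nsmul_unitAddCircle
  filter_upwards [hmp.quasiMeasurePreserving.ae hfiber] with t ht
  simp only [fiberSum_divSection_nsmul] at ht
  have hcard : (fiberIndices N S t).card ≤ N :=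
    (Finset.card_le_univ _).trans_eq (ZMod.card N)
  simpa using eq_zero_of_forall_fiberSum_eq_zero hsupp (fun j hj => ht ⟨j, hj.trans_le hcard⟩) 0

theorem hasRieszSpectrum_of_levelSet (hS : MeasurableSet S)
    (hlevel : ∀ j : Fin N, HasRieszSpectrum (levelSet N S j)) : HasRieszSpectrum S := by
  choose ι k hk using hlevel
  refine ⟨Σ j, ι j, fun p => N * k p.1 p.2 + (p.1 : ℕ), fun p => memLp_fourier _,
    exists_mul_sum_norm_sq_le_integral_sigma hS hk, fun h hh horth => ?_⟩
  set g : UnitAddCircle → ℂ := S.indicator (hh.1.mk h)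
  have hgh : g =ᵐ[volume.restrict S] h :=
    (indicator_ae_eq_restrict hS).trans hh.1.ae_eq_mk.symm
  have hg0 : ∀ t ∉ S, g t = 0 := fun t ht => indicator_of_notMem ht _
  refine hgh.symm.trans (ae_restrict_of_ae ?_)
  refine ae_eq_zero_of_forall_integral_sigma_eq_zero hS hk
    (hh.1.stronglyMeasurable_mk.measurable.indicator hS)
    ((memLp_indicator_iff_restrict hS).mpr (hh.ae_eq hh.1.ae_eq_mk))
    hg0 fun j i => ?_
  rw [← horth ⟨j, i⟩, ← setIntegral_eq_integral_of_forall_compl_eq_zero (s := S)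
    fun t ht => by rw [hg0 t ht, mul_zero]]
  refine integral_congr_ae (hgh.mono fun t ht => ?_)
  simp only [fourier_neg, ht]

end Completeness

theorem hasRieszSpectrum_setOf_lt {α : Type*} [LinearOrder α] {F : UnitAddCircle → α} {y : α}
    (hF : MeasurableSet {w | y < F w}) {p c q : ℝ} (hpq : Real.pi * (q - p) < 1) (hp : 0 ≤ p)
    (hpc : p ≤ c) (hcq : c ≤ q) (hq : q ≤ 1) (hmono : MonotoneOn (fun x : ℝ => F x) (Icc 0 c))
    (hmono' : MonotoneOn (fun x : ℝ => F x) (Icc q 1))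
    (hanti : AntitoneOn (fun x : ℝ => F x) (Icc 0 p))
    (hanti' : AntitoneOn (fun x : ℝ => F x) (Icc c 1)) : HasRieszSpectrum {w | y < F w} := by
  have h01 : F ((1 : ℝ) : UnitAddCircle) = F ((0 : ℝ) : UnitAddCircle) := by
    rw [AddCircle.coe_period, AddCircle.coe_zero]
  have hc0 : 0 ≤ c := hp.trans hpc
  have hc1 : c ≤ 1 := hcq.trans hq
  by_cases hy : y < F ((0 : ℝ) : UnitAddCircle)
  · have huniv : {w | y < F w} = univ := by
      refine eq_univ_of_forall fun w => ?_
      obtain ⟨x, hx, rfl⟩ := (AddCircle.coe_image_Ioc_eq (1 : ℝ) 0).symm ▸ mem_univ w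
      rw [zero_add] at hx
      rcases le_total x c with hxc | hcx
      · exact hy.trans_le (hmono ⟨le_rfl, hc0⟩ ⟨hx.1.le, hxc⟩ hx.1.le)
      · exact (h01 ▸ hy).trans_le (hanti' ⟨hcx, hx.2⟩ ⟨hc1, le_rfl⟩ hx.2)
    rw [huniv]
    exact hasRieszSpectrum_univ
  · refine hasRieszSpectrum_of_ordConnected hF (t := 0) hpq ?_ ⟨?_⟩ <;> rw [zero_add]
    · rintro x ⟨hxy, hx0, hx1⟩
      refine ⟨le_of_not_gt fun hxp => hy ?_, le_of_not_gt fun hqx => hy ?_⟩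
      · exact hxy.trans_le (hanti ⟨le_rfl, hp⟩ ⟨hx0.le, hxp.le⟩ hx0.le)
      · rw [← h01]
        exact hxy.trans_le (hmono' ⟨hqx.le, hx1⟩ ⟨hq, le_rfl⟩ hx1)
    · rintro x ⟨hxy, hx0, _⟩ x' ⟨hxy', _, hx1'⟩ z ⟨hxz, hzx'⟩
      refine ⟨?_, hx0.trans_le hxz, hzx'.trans hx1'⟩
      rcases le_total z c with hzc | hcz
      · exact hxy.trans_le (hmono ⟨hx0.le, hxz.trans hzc⟩ ⟨(hx0.trans_le hxz).le, hzc⟩ hxz)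
      · exact hxy'.trans_le (hanti' ⟨hcz, hzx'.trans hx1'⟩ ⟨hcz.trans hzx', hx1'⟩ hzx')

theorem le_add_intCast_of_le {x y r : ℝ} {k : ℤ} (hx : 0 ≤ x) (hy : y ≤ 1) (hr : r ∈ Ioo 0 1)
    (h : y ≤ r ∨ r < x) (hk : x ≤ r + k) : y ≤ r + k := by
  have hk0 : 0 ≤ k := by
    have : (-1 : ℝ) < k := by linarith [hr.2]
    exact Int.lt_iff_add_one_le.mp (by exact_mod_cast this)
  rcases hk0.eq_or_lt with rfl | hk1
  · rw [Int.cast_zero, add_zero] at hk ⊢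
    exact h.resolve_right hk.not_gt
  · have : (1 : ℝ) ≤ k := by exact_mod_cast hk1
    linarith [hr.1]

theorem add_intCast_le_of_le {x y r : ℝ} {k : ℤ} (hx : 0 ≤ x) (hy : y ≤ 1) (hr : r ∈ Ioo 0 1)
    (h : y < r ∨ r ≤ x) (hk : r + k ≤ y) : r + k ≤ x := by
  have hreflect := le_add_intCast_of_le (x := 1 - y) (y := 1 - x) (r := 1 - r) (k := -k)
    (by linarith) (by linarith) ⟨by linarith [hr.2], by linarith [hr.1]⟩
    (h.symm.imp (by intro; linarith) (by intro; linarith)) (by push_cast; linarith)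
  push_cast at hreflect
  linarith

section UnionIntervals

variable {N : ℕ} [NeZero N]

theorem preimageCount_coe (C : Set UnitAddCircle) (x : ℝ) :
    preimageCount N C x = (fiberIndices N C ((x / N : ℝ) : UnitAddCircle)).card := by
  rw [← preimageCount_nsmul, ← AddCircle.coe_nsmul, nsmul_eq_mul,
    mul_div_cancel₀ _ (NeZero.ne (N : ℝ))]

theorem mem_fiberIndices_image_coe {S : Set ℝ} {x : ℝ} {l : ZMod N} :
    l ∈ fiberIndices N ((↑) '' S) ((x / N : ℝ) : UnitAddCircle) ↔
      ∃ m : ℤ, (m : ZMod N) = l ∧ (x + m) / N ∈ S := by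
  have hadd (m : ℤ) : ((x / N : ℝ) : UnitAddCircle) + ZMod.toAddCircle (m : ZMod N) =
      (((x + m) / N : ℝ) : UnitAddCircle) := by
    rw [ZMod.toAddCircle_intCast, ← AddCircle.coe_add, ← add_div]
  rw [mem_fiberIndices]
  constructor
  · rintro ⟨s, hs, hsl⟩
    obtain ⟨m, rfl⟩ := ZMod.intCast_surjective l
    rw [hadd, ← sub_eq_zero, ← AddCircle.coe_sub, AddCircle.coe_eq_zero_iff] at hsl
    obtain ⟨n, hn⟩ := hsl
    refine ⟨m + n * N, by simp, ?_⟩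
    convert hs using 1
    have hN : (N : ℝ) ≠ 0 := NeZero.ne _
    rw [zsmul_eq_mul, mul_one, eq_sub_iff_add_eq] at hn
    rw [← hn]
    push_cast
    field_simp
    ring
  · rintro ⟨m, rfl, hm⟩
    exact ⟨_, hm, (hadd m).symm⟩

theorem preimageCount_image_coe_le {S : Set ℝ} {x y : ℝ}
    (h : ∀ m : ℤ, (x + m) / N ∈ S → (y + m) / N ∈ S) :
    preimageCount N ((↑) '' S) x ≤ preimageCount N ((↑) '' S) y := by
  rw [preimageCount_coe, preimageCount_coe]
  refine Finset.card_le_card fun l hl => ?_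
  rw [mem_fiberIndices_image_coe] at hl ⊢
  obtain ⟨m, hml, hm⟩ := hl
  exact ⟨m, hml, h m hm⟩

variable {κ : Type*} {a b : κ → ℝ}

theorem monotoneOn_preimageCount {u v : ℝ} (hu : 0 ≤ u) (hv : v ≤ 1)
    (hb : ∀ j, ∃ k : ℤ, N * b j - k ∈ Ioo (0 : ℝ) 1 ∧ (v ≤ N * b j - k ∨ N * b j - k < u)) :
    MonotoneOn (fun x : ℝ => preimageCount N ((↑) '' ⋃ j, Icc (a j) (b j)) x) (Icc u v) := by
  refine fun x hx y hy hxy => preimageCount_image_coe_le fun m => ?_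
  have hN : (0 : ℝ) < N := Nat.cast_pos.mpr (NeZero.pos N)
  simp only [mem_iUnion, mem_Icc, le_div_iff₀ hN, div_le_iff₀ hN]
  rintro ⟨j, haj, hbj⟩
  obtain ⟨k, hk, huv⟩ := hb j
  have hle := le_add_intCast_of_le (k := k - m) (hu.trans hx.1) (hy.2.trans hv) hk
    (huv.imp hy.2.trans fun h => h.trans_le hx.1) (by push_cast; linarith)
  push_cast at hle
  exact ⟨j, by linarith, by linarith⟩

theorem antitoneOn_preimageCount {u v : ℝ} (hu : 0 ≤ u) (hv : v ≤ 1)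
    (ha : ∀ j, ∃ k : ℤ, N * a j - k ∈ Ioo (0 : ℝ) 1 ∧ (v < N * a j - k ∨ N * a j - k ≤ u)) :
    AntitoneOn (fun x : ℝ => preimageCount N ((↑) '' ⋃ j, Icc (a j) (b j)) x) (Icc u v) := by
  refine fun x hx y hy hxy => preimageCount_image_coe_le fun m => ?_
  have hN : (0 : ℝ) < N := Nat.cast_pos.mpr (NeZero.pos N)
  simp only [mem_iUnion, mem_Icc, le_div_iff₀ hN, div_le_iff₀ hN]
  rintro ⟨j, haj, hbj⟩
  obtain ⟨k, hk, huv⟩ := ha j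
  have hle := add_intCast_le_of_le (k := k - m) (hu.trans hx.1) (hy.2.trans hv) hk
    (huv.imp hy.2.trans_lt fun h => h.trans hx.1) (by push_cast; linarith)
  push_cast at hle
  exact ⟨j, by linarith, by linarith⟩

theorem hasRieszSpectrum_levelSet_image_iUnion_Icc [Finite κ] {p c q : ℝ} (hp : 0 ≤ p)
    (hq : q ≤ 1) (hpc : p < c) (hcq : c < q) (hpq : Real.pi * (q - p) < 1)
    (ha : ∀ j, ∃ k : ℤ, N * a j - k ∈ Ioo p c) (hb : ∀ j, ∃ k : ℤ, N * b j - k ∈ Ioo c q)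
    (j : ℕ) : HasRieszSpectrum (levelSet N ((↑) '' ⋃ j, Icc (a j) (b j)) j) := by
  have hC : IsCompact ((↑) '' ⋃ j, Icc (a j) (b j) : Set UnitAddCircle) :=
    (isCompact_iUnion fun j => isCompact_Icc).image (AddCircle.continuous_mk' 1)
  have hc0 : 0 ≤ c := hp.trans hpc.le
  have hc1 : c ≤ 1 := hcq.le.trans hq
  have hIa : Ioo p c ⊆ Ioo 0 1 := Ioo_subset_Ioo hp hc1
  have hIb : Ioo c q ⊆ Ioo 0 1 := Ioo_subset_Ioo hc0 hq
  exact hasRieszSpectrum_setOf_lt (measurableSet_levelSet hC.measurableSet j) hpq hp hpc.le hcq.le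
    hq (monotoneOn_preimageCount le_rfl hc1 fun j => (hb j).imp fun k hk => ⟨hIb hk, .inl hk.1.le⟩)
    (monotoneOn_preimageCount (hc0.trans hcq.le) le_rfl fun j =>
      (hb j).imp fun k hk => ⟨hIb hk, .inr hk.2⟩)
    (antitoneOn_preimageCount le_rfl (hpc.le.trans hc1) fun j =>
      (ha j).imp fun k hk => ⟨hIa hk, .inl hk.1⟩)
    (antitoneOn_preimageCount hc0 le_rfl fun j => (ha j).imp fun k hk => ⟨hIa hk, .inr hk.2.le⟩)

end UnionIntervals

theorem expFun_intCast (n : ℤ) (x : ℝ) : expFun n x = fourier n (x : UnitAddCircle) := by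
  rw [fourier_coe_apply, expFun]
  push_cast
  rw [div_one]

theorem continuous_expFun_intCast (n : ℤ) : Continuous (expFun n) := by
  rw [funext (expFun_intCast n)]
  exact (fourier n).continuous.comp (AddCircle.continuous_mk' 1)

section Line

variable {S : Set ℝ}

theorem preimage_equivIoc_eq_image_coe (hS : S ⊆ Ioc 0 1) :
    (fun t : UnitAddCircle => (AddCircle.equivIoc 1 0 t : ℝ)) ⁻¹' S = (↑) '' S := by
  ext t
  refine ⟨fun ht => ⟨_, ht, AddCircle.coe_equivIoc⟩, ?_⟩
  rintro ⟨x, hx, rfl⟩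
  rwa [mem_preimage, AddCircle.equivIoc_coe_of_mem (by simpa using hS hx)]

theorem setIntegral_norm_sq_sum_expFun_le (hS : S ⊆ Ioc 0 1) {ι : Type*} {k : ι → ℤ}
    (hk : Function.Injective k) (s : Finset ι) (a : ι → ℂ) :
    ∫ x in S, ‖∑ i ∈ s, a i * expFun (k i) x‖ ^ 2 ≤ ∑ i ∈ s, ‖a i‖ ^ 2 := by
  have hcont : Continuous fun x => ‖∑ i ∈ s, a i * expFun (k i) x‖ ^ 2 := by
    have := continuous_expFun_intCast
    fun_prop
  calc ∫ x in S, ‖∑ i ∈ s, a i * expFun (k i) x‖ ^ 2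
      ≤ ∫ x in Ioc 0 (0 + 1), ‖∑ i ∈ s, a i * expFun (k i) x‖ ^ 2 := by
        rw [zero_add]
        exact setIntegral_mono_set hcont.integrableOn_Ioc (.of_forall fun x => by positivity)
          hS.eventuallyLE
    _ = ∫ t : UnitAddCircle, ‖∑ i ∈ s, a i * fourier (k i) t‖ ^ 2 := by
        simp only [expFun_intCast]
        exact UnitAddCircle.integral_preimage 0 fun t => ‖∑ i ∈ s, a i * fourier (k i) t‖ ^ 2
    _ = ∑ i ∈ s, ‖a i‖ ^ 2 := by rw [integral_norm_sq_sum_fourier_comp hk, one_mul]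

theorem isCompleteRieszFischer_expFun (hmS : MeasurableSet S) (hS : S ⊆ Ioc 0 1) {ι : Type*}
    {k : ι → ℤ} (hk : IsCompleteRieszFischer (volume.restrict ((↑) '' S))
      fun i (t : UnitAddCircle) => fourier (k i) t) :
    IsCompleteRieszFischer (volume.restrict S) fun i => expFun (k i) := by
  have hφ := (measurePreserving_coe_equivIoc (ℓ := 1) 0).restrict_preimage hmS
  rw [preimage_equivIoc_eq_image_coe hS, Measure.restrict_restrict hmS,
    inter_eq_self_of_subset_left (by rwa [zero_add])] at hφ
  refine .of_comp hφ (fun i => (continuous_expFun_intCast _).aestronglyMeasurable) ?_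
  simpa only [expFun_intCast, AddCircle.coe_equivIoc] using hk

theorem exists_isExpRieszBasis_of_hasRieszSpectrum (hmS : MeasurableSet S) (hS : S ⊆ Ioc 0 1)
    (h : HasRieszSpectrum ((↑) '' S)) :
    ∃ Λ : Set ℤ, IsExpRieszBasis S fun n : Λ => ((n : ℤ) : ℝ) := by
  obtain ⟨ι, k, hk⟩ := h
  have hrange := hk.comp_equiv (Equiv.ofInjective k hk.injective_frequency).symm
  simp only [Function.comp_def, Equiv.apply_ofInjective_symm hk.injective_frequency] at hrange
  have hexp := isCompleteRieszFischer_expFun hmS hS hrange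
  refine ⟨range k, _, fun n => (hexp.memLp n).coeFn_toLp, hexp.isRieszBasis (B := 1) fun s a => ?_⟩
  rw [one_mul]
  exact setIntegral_norm_sq_sum_expFun_le hS Subtype.val_injective s a

end Line

theorem eq_zero_of_sum_intCast_mul_eq_intCast {d : Type*} [Fintype d] {x : d → ℝ}
    (hx : LinearIndependent ℚ (Sum.elim x fun _ : Unit => (1 : ℝ))) {k : d → ℤ} {m : ℤ}
    (hkm : ∑ i, k i * x i = m) : k = 0 := by
  have h := Fintype.linearIndependent_iff.mp hx
    (Sum.elim (fun i => (k i : ℚ)) fun _ => -(m : ℚ)) (by simp [Rat.smul_def, hkm])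
  exact funext fun i => by simpa using h (.inl i)

theorem claim4p3 (L : ℕ) (a b : Fin L → ℝ) (S : Set ℝ)
    (hab : ∀ j, a j ≤ b j)
    (hS : S = ⋃ j, Set.Icc (a j) (b j))
    (hS01 : S ⊆ Set.Icc 0 1)
    (hind : LinearIndependent ℚ (Sum.elim (Sum.elim a b) (fun _ : Unit => (1 : ℝ)))) :
    ∃ Λ : Set ℤ, IsExpRieszBasis S (fun n : Λ => ((n : ℤ) : ℝ)) := by
  have hcompact : IsCompact S := hS ▸ isCompact_iUnion fun j => isCompact_Icc
  have hSIoc : S ⊆ Ioc 0 1 := by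
    refine fun x hx => ⟨?_, (hS01 hx).2⟩
    obtain ⟨j, hxj⟩ := mem_iUnion.mp (hS ▸ hx)
    have haj : 0 ≤ a j := (hS01 (hS ▸ mem_iUnion_of_mem j (left_mem_Icc.mpr (hab j)))).1
    exact (haj.lt_of_ne' (hind.ne_zero (Sum.inl (Sum.inl j)))).trans_le hxj.1
  obtain ⟨N, hN, hNab⟩ := exists_pos_nat_mul_sub_int_mem_Ioo
    (p := Sum.elim (fun _ => 0.45) fun _ => 0.5) (q := Sum.elim (fun _ => 0.5) fun _ => 0.55)
    (fun _ _ => eq_zero_of_sum_intCast_mul_eq_intCast hind) (by rintro (_ | _) <;> norm_num)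
  have : NeZero N := ⟨hN.ne'⟩
  refine exists_isExpRieszBasis_of_hasRieszSpectrum hcompact.measurableSet hSIoc
    (hasRieszSpectrum_of_levelSet (N := N)
      (hcompact.image (AddCircle.continuous_mk' 1)).measurableSet fun j => ?_)
  rw [hS]
  exact hasRieszSpectrum_levelSet_image_iUnion_Icc (p := 0.45) (c := 0.5) (q := 0.55)
    (by norm_num) (by norm_num) (by norm_num) (by norm_num) (by linarith [Real.pi_lt_four])
    (fun j => hNab (.inl j)) (fun j => hNab (.inr j)) j
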